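/- Let $\mathbb T^2=\mathbb R/\mathbb Z\times\mathbb R/\mathbb Z$ with normalized Lebesgue measure $\mu$, and let $S_t(x_1,x_2)=(x_1+t,x_2)$. A diffeomorphism $T$ of $\mathbb T^2$ is said to be constructed by the approximation by conjugation (AbC, Anosov–Katok) method if $T=\lim_{n\to\infty}T_n$ in the $C^\infty$ topology of $\mathrm{Diff}^\infty(\mathbb T^2)$, where $$T_n=H_n\circ S_{\alpha_{n+1}}\circ H_n^{-1},\qquad H_n=h_1\circ\cdots\circ h_n,$$ each $h_n$ is a $\mu$-preserving $C^\infty$ diffeomorphism of $\mathbb T^2$ with $h_n\circ S_{\alpha_n}=S_{\alpha_n}\circ h_n$, and $\alpha_n=p_n/q_n$ with $p_n\in\mathbb Z$, $q_n\ge 1$, $p_{n+1}=k_nl_nq_np_n+1$, $q_{n+1}=k_nl_nq_n^2$ for some positive integers $k_n,l_n$ ($n\ge 1$). A point $x$ is called generic for $T$ if $\frac1N\sum_{i=0}^{N-1}\varphi(T^ix)\to\int_{\mathbb T^2}\varphi\,d\mu$ as $N\to\infty$ for every continuous $\varphi:\mathbb T^2\to\mathbb R$, and non-generic otherwise. Theorem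 E. For every real number $\alpha$ with $1<\alpha<2$ there exists a $\mu$-preserving $C^\infty$ diffeomorphism $T$ of $\mathbb T^2$, constructed by the AbC method and ergodic with respect to $\mu$, such that the set $B_\alpha$ of all non-generic points of $T$ satisfies $\mu(B_\alpha)=0$ and $$\alpha-1\le\dim_H(B_\alpha)\le\alpha .$$ -/

import Mathlib

open MeasureTheory Filter
open scoped Topology ContDiff

/-- The two-dimensional torus `ℝ/ℤ × ℝ/ℤ`. Its metric is the maximum of the two arc-length metrics
(bi-Lipschitz equivalent to the flat one, so with the same Hausdorff dimensions), and `volume` on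
it is the normalized Lebesgue measure. -/
abbrev Torus : Type := UnitAddCircle × UnitAddCircle

/-- The covering map `ℝ² → 𝕋²`. -/
def torusMk (v : ℝ × ℝ) : Torus := ((v.1 : UnitAddCircle), (v.2 : UnitAddCircle))

/-- `F : ℝ² → ℝ²` is a `C^∞` lift of the self-map `f` of the torus. -/
def IsSmoothLift (F : ℝ × ℝ → ℝ × ℝ) (f : Torus → Torus) : Prop :=
  ContDiff ℝ ∞ F ∧ ∀ v, torusMk (F v) = f (torusMk v)

/-- A bijection of the torus is a `C^∞` diffeomorphism: it and its inverse are smooth, that is,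
have smooth lifts to the universal cover. -/
def IsSmoothDiffeo (f : Equiv.Perm Torus) : Prop :=
  (∃ F, IsSmoothLift F f) ∧ (∃ F, IsSmoothLift F f.symm)

/-- Convergence of smooth self-maps of the torus in the `C^∞` topology: for suitable lifts, the
derivatives of every order converge uniformly. -/
def TendstoSmooth (f : ℕ → Torus → Torus) (g : Torus → Torus) : Prop :=
  ∃ (F : ℕ → ℝ × ℝ → ℝ × ℝ) (G : ℝ × ℝ → ℝ × ℝ),
    (∀ n, IsSmoothLift (F n) (f n)) ∧ IsSmoothLift G g ∧
    ∀ k : ℕ, TendstoUniformly (fun n => iteratedFDeriv ℝ k (F n)) (iteratedFDeriv ℝ k G) atTop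

/-- The circle action `S_t (x₁, x₂) = (x₁ + t, x₂)`. -/
def circleAction (t : UnitAddCircle) : Equiv.Perm Torus where
  toFun x := (x.1 + t, x.2)
  invFun x := (x.1 - t, x.2)
  left_inv x := by simp
  right_inv x := by simp

/-- The data of an approximation-by-conjugation construction on the torus. Indices start at `0`:
`p n / q n` is `α_{n+1}` and `h n` is `h_{n+1}` in the usual numbering. -/
structure AbCScheme where
  /-- numerators of the rotation numbers -/
  p : ℕ → ℤ
  /-- denominators of the rotation numbers -/
  q : ℕ → ℕ
  /-- the first parameter sequence -/
  k : ℕ → ℕ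
  /-- the second parameter sequence -/
  l : ℕ → ℕ
  /-- the conjugating diffeomorphisms -/
  h : ℕ → Equiv.Perm Torus
  q_zero_pos : 0 < q 0
  k_pos : ∀ n, 0 < k n
  l_pos : ∀ n, 0 < l n
  p_succ : ∀ n, p (n + 1) = k n * l n * q n * p n + 1
  q_succ : ∀ n, q (n + 1) = k n * l n * q n ^ 2
  smooth : ∀ n, IsSmoothDiffeo (h n)
  area_preserving : ∀ n, MeasurePreserving (h n) volume volume
  commute : ∀ n,
    circleAction (((p n : ℝ) / (q n : ℝ) : ℝ) : UnitAddCircle) * h n =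
      h n * circleAction (((p n : ℝ) / (q n : ℝ) : ℝ) : UnitAddCircle)

namespace AbCScheme

/-- The rational rotation number `p n / q n`, modulo `1`. -/
noncomputable def rot (D : AbCScheme) (n : ℕ) : UnitAddCircle :=
  (((D.p n : ℝ) / (D.q n : ℝ) : ℝ) : UnitAddCircle)

/-- The composition `h 0 ∘ h 1 ∘ ⋯ ∘ h (n - 1)` of the first `n` conjugating maps. -/
def H (D : AbCScheme) : ℕ → Equiv.Perm Torus
  | 0 => 1
  | n + 1 => D.H n * D.h n

/-- The periodic diffeomorphism `H ∘ S_{p (n+1) / q (n+1)} ∘ H⁻¹`, with `H = h 0 ∘ ⋯ ∘ h n`. -/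
noncomputable def T (D : AbCScheme) (n : ℕ) : Equiv.Perm Torus :=
  D.H (n + 1) * circleAction (D.rot (n + 1)) * (D.H (n + 1))⁻¹

end AbCScheme

/-- `f` is obtained by the approximation-by-conjugation method: it is the limit, in the topology
of `Diff^∞(𝕋²)`, of the periodic diffeomorphisms of some scheme. -/
def IsAbC (f : Equiv.Perm Torus) : Prop :=
  ∃ D : AbCScheme,
    TendstoSmooth (fun n => D.T n) f ∧ TendstoSmooth (fun n => (D.T n).symm) f.symm

/-- `x` is a generic point of `f` for `μ`: the Birkhoff averages at `x` of every compactly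
supported continuous function converge to its `μ`-integral. -/
def IsBirkhoffGeneric {X : Type*} [TopologicalSpace X] [MeasurableSpace X] (f : X → X)
    (μ : Measure X) (x : X) : Prop :=
  ∀ φ : X → ℝ, Continuous φ → HasCompactSupport φ →
    Tendsto (fun N : ℕ => birkhoffAverage ℝ f φ N x) atTop (𝓝 (∫ y, φ y ∂μ))

/-- The set of all non-generic points. -/
def nonGenericSet {X : Type*} [TopologicalSpace X] [MeasurableSpace X] (f : X → X)
    (μ : Measure X) : Set X :=
  {x | ¬ IsBirkhoffGeneric f μ x}

/-! One diffeomorphism serves every `α`: since `α - 1 ≤ 1 ≤ α`, it is enough that the non-generic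
set be null of Hausdorff dimension exactly `1` (`exists_isAbC_dimH_nonGenericSet_eq_one`).

Each conjugating map `h` is a quasi-rotation (`exists_isQuasiRotation`): a product of three shears
that commutes with the rotation by `1/q`, preserves the circle `y = 0`, and carries each horizontal
circle not too close to `y = 0` to a curve near a line `Y = const - q X`, apart from a short
parameter arc. The shears are built from a Möbius map `F` of the circle that pushes everything
except a small ball around `1/2` into a small ball around `0`.

Lower bound: the limit `T` preserves `y = 0`, so no point of that circle is generic
(`not_isBirkhoffGeneric_of_invariant_circle`).

Genericity: for times between consecutive values of `timeScale`, `T` is indistinguishable from a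
periodic approximation whose rotation number is `p/q` plus a tiny drift. An average over the
`p/q`-orbit is nearly an integral over a horizontal circle, which the previous quasi-rotation turns
into a steep, hence equidistributed, line. The drift moves the height of that circle at constant
speed, and only heights near `0` are harmful. An orbit whose initial height is far from `0` spends
little time there (`card_visits_mul_le`, `abs_birkhoffSum_approx_le`). The starting point qualifies
if it avoids the bad sets of two successive stages, so every non-generic point lies in infinitely
many `badSet n`.

Upper bound: `badSet n` is the image under the composition `H` of a `1/J`-neighbourhood of `q`
vertical circles and one horizontal circle. As `J` is chosen after `q` and the Lipschitz constant of
`H`, and enormous compared with both, these images are covered as cheaply as curves. The limsup set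
is null and has dimension at most `1` (`volume_frequently_badSet`, `dimH_frequently_badSet_le`).
Genericity almost everywhere also yields ergodicity. -/

/-! ### Möbius maps of the circle that concentrate near one point. -/

/-- The displacement of the lift `a ↦ a + mobiusDisp r a` of a Möbius transformation acting on the
circle. -/
noncomputable def mobiusDisp (r a : ℝ) : ℝ :=
  -(Real.arctan (r * Real.sin (2 * Real.pi * a) / (1 + r * Real.cos (2 * Real.pi * a))) / Real.pi)

lemma one_add_mul_cos_pos {r : ℝ} (h0 : 0 ≤ r) (h1 : r < 1) (x : ℝ) :
    0 < 1 + r * Real.cos x := by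
  nlinarith [Real.neg_one_le_cos x]

lemma contDiff_mobiusDisp {r : ℝ} (h0 : 0 ≤ r) (h1 : r < 1) : ContDiff ℝ ∞ (mobiusDisp r) := by
  have h : ContDiff ℝ ∞ fun a : ℝ =>
      r * Real.sin (2 * Real.pi * a) / (1 + r * Real.cos (2 * Real.pi * a)) := by
    refine ContDiff.div (by fun_prop) (by fun_prop) fun a => (one_add_mul_cos_pos h0 h1 _).ne'
  exact ((Real.contDiff_arctan.comp h).div_const _).neg

lemma mobiusDisp_periodic (r : ℝ) : Function.Periodic (mobiusDisp r) 1 := fun a => by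
  simp [mobiusDisp, mul_add, Real.sin_add_two_pi, Real.cos_add_two_pi]

lemma mobiusDisp_neg (r a : ℝ) : mobiusDisp r (-a) = -mobiusDisp r a := by
  simp [mobiusDisp, neg_div, Real.arctan_neg]

lemma abs_mobiusDisp_le (r a : ℝ) : |mobiusDisp r a| ≤ 1 / 2 := by
  rw [mobiusDisp, abs_neg, abs_div, abs_of_pos Real.pi_pos, div_le_iff₀ Real.pi_pos, abs_le]
  have h1 := Real.arctan_lt_pi_div_two
    (r * Real.sin (2 * Real.pi * a) / (1 + r * Real.cos (2 * Real.pi * a)))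
  have h2 := Real.neg_pi_div_two_lt_arctan
    (r * Real.sin (2 * Real.pi * a) / (1 + r * Real.cos (2 * Real.pi * a)))
  constructor <;> linarith

/-- The map is the boundary action of `z ↦ (z + r) / (1 + r z)`, so its derivative is a Poisson
kernel; positivity for `r < 1` makes it a diffeomorphism. -/
lemma hasDerivAt_add_mobiusDisp {r : ℝ} (h0 : 0 ≤ r) (h1 : r < 1) (a : ℝ) :
    HasDerivAt (fun a => a + mobiusDisp r a)
      ((1 - r ^ 2) / (1 + 2 * r * Real.cos (2 * Real.pi * a) + r ^ 2)) a := by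
  have hp := one_add_mul_cos_pos h0 h1 (2 * Real.pi * a)
  have hθ : HasDerivAt (fun a : ℝ => 2 * Real.pi * a) (2 * Real.pi) a := by
    simpa using (hasDerivAt_id a).const_mul (2 * Real.pi)
  have hs := (hθ.sin.const_mul r)
  have hc := (hθ.cos.const_mul r).const_add 1
  have h := (hasDerivAt_id a).add (((hs.div hc hp.ne').arctan.div_const Real.pi).neg)
  refine h.congr_deriv ?_
  have hsq := Real.sin_sq_add_cos_sq (2 * Real.pi * a)
  set s := Real.sin (2 * Real.pi * a)
  set c := Real.cos (2 * Real.pi * a)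
  have hq : 0 < 1 + 2 * r * c + r ^ 2 := by nlinarith [sq_nonneg (r * s), sq_pos_of_pos hp]
  have hq' : 1 + (r * s / (1 + r * c)) ^ 2 = (1 + 2 * r * c + r ^ 2) / (1 + r * c) ^ 2 := by
    field_simp
    linear_combination r ^ 2 * hsq
  have hpi := Real.pi_pos.ne'
  simp only [Pi.div_apply]
  rw [hq']
  field_simp
  linear_combination (-2 * r ^ 2) * hsq

lemma strictMono_add_mobiusDisp {r : ℝ} (h0 : 0 ≤ r) (h1 : r < 1) :
    StrictMono fun a => a + mobiusDisp r a := by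
  refine strictMono_of_deriv_pos fun a => ?_
  rw [(hasDerivAt_add_mobiusDisp h0 h1 a).deriv]
  have hp := Real.neg_one_le_cos (2 * Real.pi * a)
  apply div_pos <;> nlinarith [sq_nonneg (1 - r)]

/-- A circle diffeomorphism, given by the displacements `f` and `g` of a lift and of its inverse,
which maps the complement of the `η`-ball around `1/2` into the `η`-ball around `0`. -/
lemma exists_concentrating_circleDiffeo {η : ℝ} (hη : 0 < η) (hη' : η < 1 / 2) :
    ∃ f g : ℝ → ℝ, ContDiff ℝ ∞ f ∧ ContDiff ℝ ∞ g ∧ Function.Periodic f 1 ∧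
      Function.Periodic g 1 ∧ (∀ x, |f x| ≤ 1 / 2) ∧ (∀ x, |g x| ≤ 1 / 2) ∧
      (∀ x, g (x + f x) = -f x) ∧ (∀ x, f (x + g x) = -g x) ∧
      ∀ a, |a| ≤ 1 / 2 - η → |a + f a| ≤ η := by
  obtain ⟨r, h0, h1, hr⟩ : ∃ r : ℝ, 0 ≤ r ∧ r < 1 ∧
      1 / 2 - η + mobiusDisp r (1 / 2 - η) < η := by
    have hcos : 0 < Real.cos (Real.pi * (1 / 2 - η)) := by
      apply Real.cos_pos_of_mem_Ioo
      constructor <;> nlinarith [Real.pi_pos]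
    have hmul : 2 * Real.pi * (1 / 2 - η) = 2 * (Real.pi * (1 / 2 - η)) := by ring
    -- At `r = 1` the Möbius map degenerates: by the half-angle formula it sends this point to `0`.
    -- Continuity in `r` then supplies some `r < 1`, and monotonicity and oddness extend the bound
    -- from the endpoint to the whole interval.
    have hval : mobiusDisp 1 (1 / 2 - η) = -(1 / 2 - η) := by
      have : 1 * Real.sin (2 * Real.pi * (1 / 2 - η)) /
          (1 + 1 * Real.cos (2 * Real.pi * (1 / 2 - η))) = Real.tan (Real.pi * (1 / 2 - η)) := by
        rw [hmul, Real.sin_two_mul, Real.cos_two_mul, Real.tan_eq_sin_div_cos]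
        generalize Real.pi * (1 / 2 - η) = x at hcos ⊢
        rw [show 1 + 1 * (2 * Real.cos x ^ 2 - 1) = 2 * Real.cos x ^ 2 by ring]
        field_simp
      rw [mobiusDisp, this, Real.arctan_tan]
      · field_simp
      · nlinarith [Real.pi_pos]
      · nlinarith [Real.pi_pos]
    have hden : 1 + 1 * Real.cos (2 * Real.pi * (1 / 2 - η)) ≠ 0 := by
      rw [hmul, Real.cos_two_mul]
      nlinarith [sq_pos_of_pos hcos]
    have hcont : ContinuousAt (fun r => 1 / 2 - η + mobiusDisp r (1 / 2 - η)) 1 := by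
      have : ContinuousAt (fun r : ℝ => r * Real.sin (2 * Real.pi * (1 / 2 - η)) /
          (1 + r * Real.cos (2 * Real.pi * (1 / 2 - η)))) 1 :=
        ContinuousAt.div (by fun_prop) (by fun_prop) hden
      exact ((Real.continuous_arctan.continuousAt.comp this).div_const _).neg.const_add _
    have hlt : 1 / 2 - η + mobiusDisp 1 (1 / 2 - η) < η := by rw [hval]; linarith
    have h1 := (hcont.eventually (Iio_mem_nhds hlt)).filter_mono
      (nhdsWithin_le_nhds (s := Set.Iio 1))
    have h2 : ∀ᶠ r : ℝ in 𝓝[<] 1, r ∈ Set.Ioo (0 : ℝ) 1 := Ioo_mem_nhdsLT one_pos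
    obtain ⟨r, hr, hr'⟩ := (h1.and h2).exists
    exact ⟨r, hr'.1.le, hr'.2, hr⟩
  have hmono := strictMono_add_mobiusDisp h0 h1
  have hsm := contDiff_mobiusDisp h0 h1
  have hF : ContDiff ℝ ∞ fun a => a + mobiusDisp r a := contDiff_id.add hsm
  have hsurj : Function.Surjective fun a => a + mobiusDisp r a := by
    refine hF.continuous.surjective ?_ ?_
    · exact tendsto_atTop_mono (fun a => by
        have := (abs_le.1 (abs_mobiusDisp_le r a)).1
        show id a + -(1 / 2) ≤ _
        simp only [id]; linarith)
        (tendsto_atTop_add_const_right _ (-(1 / 2 : ℝ)) tendsto_id)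
    · exact tendsto_atBot_mono (fun a => by
        have := (abs_le.1 (abs_mobiusDisp_le r a)).2
        show _ ≤ id a + 1 / 2
        simp only [id]; linarith)
        (tendsto_atBot_add_const_right _ (1 / 2 : ℝ) tendsto_id)
  let Φ : ℝ ≃ₜ ℝ := (hmono.orderIsoOfSurjective _ hsurj).toHomeomorph
  have hΦ : ∀ a, Φ a = a + mobiusDisp r a := fun a => rfl
  have hΦs : ∀ y, Φ.symm y + mobiusDisp r (Φ.symm y) = y := fun y => by
    rw [← hΦ, Φ.apply_symm_apply]
  have hsmooth : ContDiff ℝ ∞ Φ.symm := by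
    refine Φ.contDiff_symm_deriv (fun x => ?_) (hasDerivAt_add_mobiusDisp h0 h1) hF
    have hp := Real.neg_one_le_cos (2 * Real.pi * x)
    apply ne_of_gt
    apply div_pos <;> nlinarith [sq_nonneg (1 - r)]
  refine ⟨mobiusDisp r, fun y => Φ.symm y - y, hsm, hsmooth.sub contDiff_id,
    mobiusDisp_periodic r, fun y => ?_, abs_mobiusDisp_le r, fun y => ?_, fun x => ?_, fun y => ?_,
    fun a ha => ?_⟩
  · have : Φ.symm (y + 1) = Φ.symm y + 1 := by
      rw [Homeomorph.symm_apply_eq, hΦ, mobiusDisp_periodic r]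
      linarith [hΦs y]
    simp only [this]; ring
  · have := abs_mobiusDisp_le r (Φ.symm y)
    have h2 := hΦs y
    rw [abs_le] at this ⊢
    constructor <;> linarith
  · simp only [← hΦ, Φ.symm_apply_apply]; rw [hΦ]; ring
  · simp only [add_sub_cancel]; linarith [hΦs y]
  · have h := abs_le.1 ha
    have hu := hmono.monotone h.2
    have hl := hmono.monotone (show -(1 / 2 - η) ≤ a by linarith)
    simp only [mobiusDisp_neg] at hu hl
    rw [abs_le]
    constructor <;> linarith

/-! ### Area-preserving torus diffeomorphisms with lifts, and shears. -/

instance : IsProbabilityMeasure (volume : Measure UnitAddCircle) := ⟨UnitAddCircle.measure_univ⟩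

instance : IsProbabilityMeasure (volume : Measure Torus) :=
  inferInstanceAs (IsProbabilityMeasure (volume.prod volume))

lemma torusMk_surjective : Function.Surjective torusMk := by
  rintro ⟨x, y⟩
  obtain ⟨a, rfl⟩ := QuotientAddGroup.mk_surjective x
  obtain ⟨b, rfl⟩ := QuotientAddGroup.mk_surjective y
  exact ⟨(a, b), rfl⟩

lemma unitAddCircle_coe_intCast (n : ℤ) : ((n : ℝ) : UnitAddCircle) = 0 :=
  (AddCircle.coe_eq_zero_iff 1).2 ⟨n, by simp⟩

lemma torusMk_add_int (v : ℝ × ℝ) (m n : ℤ) : torusMk (v + ((m : ℝ), (n : ℝ))) = torusMk v := by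
  simp [torusMk]

lemma torusMk_add (v w : ℝ × ℝ) : torusMk (v + w) = torusMk v + torusMk w := by
  simp [torusMk]

lemma exists_int_of_torusMk_eq {v w : ℝ × ℝ} (h : torusMk v = torusMk w) :
    ∃ m n : ℤ, v = w + ((m : ℝ), (n : ℝ)) := by
  have h1 := congrArg Prod.fst h
  have h2 := congrArg Prod.snd h
  simp only [torusMk] at h1 h2
  rw [← sub_eq_zero, ← AddCircle.coe_sub, AddCircle.coe_eq_zero_iff] at h1 h2
  obtain ⟨m, hm⟩ := h1
  obtain ⟨n, hn⟩ := h2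
  refine ⟨m, n, Prod.ext ?_ ?_⟩
  · simp at hm ⊢; linarith
  · simp at hn ⊢; linarith

lemma continuous_torusMk : Continuous torusMk :=
  ((AddCircle.continuous_mk' 1).comp continuous_fst).prodMk
    ((AddCircle.continuous_mk' 1).comp continuous_snd)

/-- An area-preserving diffeomorphism of the torus together with a smooth lift of it that commutes
with integer translations. -/
structure TorusDiffeo where
  /-- the diffeomorphism -/
  toPerm : Equiv.Perm Torus
  /-- a lift to the universal cover -/
  lift : Equiv.Perm (ℝ × ℝ)
  contDiff_lift : ContDiff ℝ ∞ lift
  contDiff_symm : ContDiff ℝ ∞ lift.symm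
  lift_add : ∀ v (m n : ℤ), lift (v + ((m : ℝ), (n : ℝ))) = lift v + ((m : ℝ), (n : ℝ))
  mk_lift : ∀ v, torusMk (lift v) = toPerm (torusMk v)
  measurePreserving : MeasurePreserving toPerm volume volume

namespace TorusDiffeo

lemma symm_add (h : TorusDiffeo) (v : ℝ × ℝ) (m n : ℤ) :
    h.lift.symm (v + ((m : ℝ), (n : ℝ))) = h.lift.symm v + ((m : ℝ), (n : ℝ)) := by
  rw [Equiv.symm_apply_eq, h.lift_add, Equiv.apply_symm_apply]

lemma mk_symm (h : TorusDiffeo) (v : ℝ × ℝ) :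
    torusMk (h.lift.symm v) = h.toPerm.symm (torusMk v) := by
  rw [Equiv.eq_symm_apply, ← h.mk_lift, Equiv.apply_symm_apply]

lemma isSmoothDiffeo (h : TorusDiffeo) : IsSmoothDiffeo h.toPerm :=
  ⟨⟨h.lift, h.contDiff_lift, h.mk_lift⟩, ⟨h.lift.symm, h.contDiff_symm, h.mk_symm⟩⟩

/-- The identity. -/
protected def one : TorusDiffeo where
  toPerm := 1
  lift := 1
  contDiff_lift := contDiff_id
  contDiff_symm := contDiff_id
  lift_add _ _ _ := rfl
  mk_lift _ := rfl
  measurePreserving := MeasurePreserving.id _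

/-- The composition. -/
protected def mul (h k : TorusDiffeo) : TorusDiffeo where
  toPerm := h.toPerm * k.toPerm
  lift := h.lift * k.lift
  contDiff_lift := h.contDiff_lift.comp k.contDiff_lift
  contDiff_symm := k.contDiff_symm.comp h.contDiff_symm
  lift_add v m n := by simp only [Equiv.Perm.coe_mul, Function.comp, k.lift_add, h.lift_add]
  mk_lift v := by simp only [Equiv.Perm.coe_mul, Function.comp, h.mk_lift, k.mk_lift]
  measurePreserving := h.measurePreserving.comp k.measurePreserving

end TorusDiffeo

lemma continuous_periodic_lift {f : ℝ → ℝ} (hf : Function.Periodic f 1) (hc : Continuous f) :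
    Continuous (hf.lift : UnitAddCircle → ℝ) :=
  continuous_coinduced_dom.2 hc

lemma measurePreserving_fst_add {c : UnitAddCircle → UnitAddCircle} (hc : Measurable c) :
    MeasurePreserving (fun z : Torus => (z.1, z.2 + c z.1)) volume volume := by
  refine MeasurePreserving.skew_product (μa := volume) (μc := volume) (MeasurePreserving.id volume)
    (g := fun x y => y + c x) ?_ (Eventually.of_forall fun x => ?_)
  · exact measurable_snd.add (hc.comp measurable_fst)
  · exact (measurePreserving_add_right volume (c x)).map_eq

lemma measurePreserving_snd_add {c : UnitAddCircle → UnitAddCircle} (hc : Measurable c) :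
    MeasurePreserving (fun z : Torus => (z.1 + c z.2, z.2)) volume volume :=
  (Measure.measurePreserving_swap (μ := volume) (ν := volume)).comp
    ((measurePreserving_fst_add hc).comp
      (Measure.measurePreserving_swap (μ := volume) (ν := volume)))

namespace TorusDiffeo

/-- The shear `(x, y) ↦ (x, y + f (a x))`. -/
noncomputable def shearY (a : ℤ) (f : ℝ → ℝ) (hf : Function.Periodic f 1) (hs : ContDiff ℝ ∞ f) :
    TorusDiffeo where
  toPerm :=
    { toFun z := (z.1, z.2 + (hf.lift (a • z.1) : ℝ))
      invFun z := (z.1, z.2 - (hf.lift (a • z.1) : ℝ))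
      left_inv z := by simp
      right_inv z := by simp }
  lift :=
    { toFun v := (v.1, v.2 + f (a * v.1))
      invFun v := (v.1, v.2 - f (a * v.1))
      left_inv z := by simp
      right_inv z := by simp }
  contDiff_lift := by
    have : ContDiff ℝ ∞ fun v : ℝ × ℝ => (v.1, v.2 + f (a * v.1)) := by fun_prop
    exact this
  contDiff_symm := by
    have : ContDiff ℝ ∞ fun v : ℝ × ℝ => (v.1, v.2 - f (a * v.1)) := by fun_prop
    exact this
  lift_add v m n := by
    have := (hf.int_mul (a * m)) (a * v.1)
    simp only [mul_one, Int.cast_mul] at this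
    simp only [Equiv.coe_fn_mk, Prod.fst_add, Prod.snd_add, Prod.mk_add_mk, mul_add, this,
      Prod.mk.injEq, true_and]
    ring
  mk_lift v := by
    have : (a • (v.1 : UnitAddCircle)) = ((a * v.1 : ℝ) : UnitAddCircle) := by
      rw [← zsmul_eq_mul, AddCircle.coe_zsmul]
    simp only [torusMk, Equiv.coe_fn_mk, this, Function.Periodic.lift_coe, AddCircle.coe_add]
  measurePreserving := by
    have hc : Continuous fun x : UnitAddCircle =>
        ((hf.lift (a • x) : ℝ) : UnitAddCircle) :=
      (AddCircle.continuous_mk' 1).comp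
        ((continuous_periodic_lift hf hs.continuous).comp (continuous_zsmul a))
    exact measurePreserving_fst_add hc.measurable

/-- The shear by the function `f (a x + y)` in the direction `(1, -a)`. -/
noncomputable def shearX (a : ℤ) (f : ℝ → ℝ) (hf : Function.Periodic f 1) (hs : ContDiff ℝ ∞ f) :
    TorusDiffeo where
  toPerm :=
    { toFun z := (z.1 + (hf.lift (a • z.1 + z.2) : ℝ),
        z.2 - a • ((hf.lift (a • z.1 + z.2) : ℝ) : UnitAddCircle))
      invFun z := (z.1 - (hf.lift (a • z.1 + z.2) : ℝ),
        z.2 + a • ((hf.lift (a • z.1 + z.2) : ℝ) : UnitAddCircle))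
      left_inv z := by
        simp only [smul_add, add_add_sub_cancel]
        simp
      right_inv z := by
        simp only [smul_sub, sub_add_add_cancel]
        simp }
  lift :=
    { toFun v := (v.1 + f (a * v.1 + v.2), v.2 - a * f (a * v.1 + v.2))
      invFun v := (v.1 - f (a * v.1 + v.2), v.2 + a * f (a * v.1 + v.2))
      left_inv z := by
        simp only [mul_add, add_add_sub_cancel]
        simp
      right_inv z := by
        simp only [mul_sub, sub_add_add_cancel]
        simp }
  contDiff_lift := by
    have : ContDiff ℝ ∞ fun v : ℝ × ℝ =>
      (v.1 + f (a * v.1 + v.2), v.2 - a * f (a * v.1 + v.2)) := by fun_prop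
    exact this
  contDiff_symm := by
    have : ContDiff ℝ ∞ fun v : ℝ × ℝ =>
      (v.1 - f (a * v.1 + v.2), v.2 + a * f (a * v.1 + v.2)) := by fun_prop
    exact this
  lift_add v m n := by
    have := (hf.int_mul (a * m + n)) (a * v.1 + v.2)
    simp only [mul_one, Int.cast_mul, Int.cast_add] at this
    have h2 : (a : ℝ) * (v.1 + m) + (v.2 + n) = a * v.1 + v.2 + (a * m + n) := by ring
    simp only [Equiv.coe_fn_mk, Prod.fst_add, Prod.snd_add, Prod.mk_add_mk, h2, this,
      Prod.mk.injEq]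
    constructor <;> ring
  mk_lift v := by
    have (x : ℝ) : (a • (x : UnitAddCircle)) = ((a * x : ℝ) : UnitAddCircle) := by
      rw [← zsmul_eq_mul, AddCircle.coe_zsmul]
    simp only [torusMk, Equiv.coe_fn_mk, this, ← AddCircle.coe_add, Function.Periodic.lift_coe,
      ← AddCircle.coe_sub]
  measurePreserving := by
    have hc : Continuous fun x : UnitAddCircle => ((hf.lift x : ℝ) : UnitAddCircle) :=
      (AddCircle.continuous_mk' 1).comp (continuous_periodic_lift hf hs.continuous)
    -- The shear in direction `(1, -a)` is the horizontal shear conjugated by `(x, y) ↦ (x, a x +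
    -- y)`.
    have h1 := measurePreserving_fst_add (c := fun x => a • x) (continuous_zsmul a).measurable
    have h2 := measurePreserving_snd_add hc.measurable
    have h3 := measurePreserving_fst_add (c := fun x => -(a • x)) (continuous_zsmul a).neg.measurable
    convert! h3.comp (h2.comp h1) using 1
    funext z
    simp only [Equiv.coe_fn_mk, Function.comp, Prod.mk.injEq, add_comm (a • z.1), true_and,
      smul_add]
    abel

end TorusDiffeo

/-! ### Quasi-rotations. -/

/-- `h` commutes with the rotation by `1 / Q` and turns horizontal circles into almost vertical
ones. It is generated by the circle map `F`, which maps the complement of the `η`-ball around `1/2`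
into the `η`-ball around `0`. -/
structure IsQuasiRotation (Q : ℕ) (η : ℝ) (h : TorusDiffeo) (F : UnitAddCircle → UnitAddCircle) :
    Prop where
  injective : Function.Injective F
  lift_comm : ∀ v (p : ℤ), h.lift (v + (((p : ℝ) / Q), 0)) = h.lift v + (((p : ℝ) / Q), 0)
  map_sub : ∀ z, F (z.2 - Q • (h.toPerm z).1) = F z.2 - Q • z.1
  snd_eq : ∀ z, (h.toPerm z).2 = F (z.2 - Q • (h.toPerm z).1) - F (-(Q • (h.toPerm z).1))
  norm_fst_sub_le : ∀ z, ‖(h.toPerm z).1 - z.1‖ ≤ 1 / Q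
  norm_map_le : ∀ a, η ≤ ‖a - ((1 / 2 : ℝ) : UnitAddCircle)‖ → ‖F a‖ ≤ η

lemma unitAddCircle_norm_coe_le (x : ℝ) : ‖(x : UnitAddCircle)‖ ≤ |x| := by
  simpa using QuotientAddGroup.norm_mk_le_norm (S := AddSubgroup.zmultiples (1 : ℝ)) (m := x)

lemma unitAddCircle_norm_coe_eq {x : ℝ} (hx : |x| ≤ 1 / 2) : ‖(x : UnitAddCircle)‖ = |x| :=
  (AddCircle.norm_coe_eq_abs_iff (1 : ℝ) one_ne_zero).2 (by simpa using hx)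

lemma exists_abs_le_half (a : UnitAddCircle) : ∃ x : ℝ, |x| ≤ 1 / 2 ∧ (x : UnitAddCircle) = a := by
  obtain ⟨x, rfl⟩ := QuotientAddGroup.mk_surjective a
  refine ⟨x - round x, abs_sub_round x, ?_⟩
  rw [AddCircle.coe_sub]
  simp

lemma norm_sub_half {x : ℝ} (hx : |x| ≤ 1 / 2) :
    ‖(x : UnitAddCircle) - ((1 / 2 : ℝ) : UnitAddCircle)‖ = 1 / 2 - |x| := by
  have hle := abs_le.1 hx
  rcases le_total 0 x with h | h
  · have h1 : |x - 1 / 2| = 1 / 2 - x := by rw [abs_of_nonpos (by linarith)]; ring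
    rw [abs_of_nonneg h, ← AddCircle.coe_sub, unitAddCircle_norm_coe_eq (by rw [h1]; linarith), h1]
  · have : (x : UnitAddCircle) - ((1 / 2 : ℝ) : UnitAddCircle)
        = ((x + 1 / 2 : ℝ) : UnitAddCircle) := by
      rw [← AddCircle.coe_sub, ← sub_eq_zero, ← AddCircle.coe_sub]
      ring_nf
      simp
    have h1 : |x + 1 / 2| = x + 1 / 2 := abs_of_nonneg (by linarith)
    rw [this, abs_of_nonpos h, unitAddCircle_norm_coe_eq (by rw [h1]; linarith), h1]
    ring

/-- The circle map with displacement `f`. -/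
noncomputable def circleMapOfDisp {f : ℝ → ℝ} (hf : Function.Periodic f 1) (c : UnitAddCircle) :
    UnitAddCircle := c + (hf.lift c : ℝ)

lemma circleMapOfDisp_coe {f : ℝ → ℝ} (hf : Function.Periodic f 1) (x : ℝ) :
    circleMapOfDisp hf x = ((x + f x : ℝ) : UnitAddCircle) := by
  simp [circleMapOfDisp]

lemma exists_isQuasiRotation (Q : ℕ) (hQ : 0 < Q) {η : ℝ} (hη : 0 < η) (hη' : η < 1 / 2) :
    ∃ h F, IsQuasiRotation Q η h F := by
  obtain ⟨f, g, hfs, hgs, hf, hg, hfb, hgb, hgf, hfg, hconc⟩ :=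
    exists_concentrating_circleDiffeo hη hη'
  have hQ' : (Q : ℝ) ≠ 0 := by positivity
  have hQ'' : (0 : ℝ) < Q := by positivity
  let fa : ℝ → ℝ := fun x => -f x / Q
  let fb : ℝ → ℝ := fun x => -g x / Q
  let fc : ℝ → ℝ := fun x => -f x
  have ha : Function.Periodic fa 1 := fun x => by simp only [fa, hf x]
  have hb : Function.Periodic fb 1 := fun x => by simp only [fb, hg x]
  have hc : Function.Periodic fc 1 := fun x => by simp only [fc, hf x]
  -- Put `t = F y - Q x`. The first shear makes `t` the value of `y - Q x`; the second preserves it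
  -- and moves the first coordinate to `x'` with `F (y - Q x') = t`; the third sets the second
  -- coordinate to `t - F (-Q x')`. All three depend on `x` only through `Q x`, apart from
  -- translation.
  let A := TorusDiffeo.shearX 0 fa ha (hfs.neg.div_const _)
  let B := TorusDiffeo.shearX (-Q) fb hb (hgs.neg.div_const _)
  let C := TorusDiffeo.shearY (-Q) fc hc hfs.neg
  let h := C.mul (B.mul A)
  have key : ∀ v : ℝ × ℝ, h.lift v =
      (v.1 - f v.2 / Q - g (v.2 - Q * v.1 + f v.2) / Q,
        v.2 - g (v.2 - Q * v.1 + f v.2) -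
          f (-(Q * v.1 - f v.2 - g (v.2 - Q * v.1 + f v.2)))) := by
    intro v
    have hw : -(Q : ℝ) * (v.1 + -f v.2 / Q) + v.2 = v.2 - Q * v.1 + f v.2 := by
      field_simp
      ring
    have hx : ∀ w, -(Q : ℝ) * (v.1 + -f v.2 / Q + -w / Q) = -(Q * v.1 - f v.2 - w) := by
      intro w
      field_simp
      ring
    simp only [h, A, B, C, TorusDiffeo.mul, TorusDiffeo.shearX, TorusDiffeo.shearY,
      Equiv.Perm.coe_mul, Function.comp, Equiv.coe_fn_mk, Int.cast_zero, zero_mul, zero_add,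
      sub_zero, Int.cast_neg, Int.cast_natCast, fa, fb, fc, hw, hx, Prod.mk.injEq]
    constructor
    · ring
    · field_simp
      ring
  have hsmul : ∀ x : ℝ, Q • (x : UnitAddCircle) = ((Q * x : ℝ) : UnitAddCircle) := fun x => by
    rw [← nsmul_eq_mul, AddCircle.coe_nsmul]
  have hinj : Function.Injective (circleMapOfDisp hf) := by
    refine Function.LeftInverse.injective (g := circleMapOfDisp hg) fun a => ?_
    obtain ⟨x, rfl⟩ := QuotientAddGroup.mk_surjective a
    have h1 : circleMapOfDisp hg (circleMapOfDisp hf (x : UnitAddCircle)) = (x : UnitAddCircle) := by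
      rw [circleMapOfDisp_coe, circleMapOfDisp_coe, hgf, add_neg_cancel_right]
    exact h1
  refine ⟨h, circleMapOfDisp hf, ⟨hinj, fun v p => ?_, fun z => ?_, fun z => ?_, fun z => ?_,
    fun a ha => ?_⟩⟩
  · have hgp (x : ℝ) : g (x - p) = g x := by simpa using hg.sub_int_mul_eq p (x := x)
    have hfp (x : ℝ) : f (x - p) = f x := by simpa using hf.sub_int_mul_eq p (x := x)
    have h1 : v.2 - Q * (v.1 + p / Q) + f v.2 = v.2 - Q * v.1 + f v.2 - p := by field_simp; ring
    have h2 (w : ℝ) : -(Q * (v.1 + p / Q) - f v.2 - w) = -(Q * v.1 - f v.2 - w) - p := by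
      field_simp; ring
    rw [key, key]
    simp only [Prod.fst_add, Prod.snd_add, add_zero, h1, h2, hgp, hfp, Prod.mk_add_mk]
    congr 1; ring
  · obtain ⟨v, rfl⟩ := torusMk_surjective z
    rw [← h.mk_lift, key]
    simp only [torusMk, hsmul, ← AddCircle.coe_sub, circleMapOfDisp_coe]
    have hx : v.2 - Q * (v.1 - f v.2 / Q - g (v.2 - Q * v.1 + f v.2) / Q) =
        v.2 - Q * v.1 + f v.2 + g (v.2 - Q * v.1 + f v.2) := by field_simp; ring
    rw [hx, hfg]
    congr 1; ring
  · obtain ⟨v, rfl⟩ := torusMk_surjective z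
    rw [← h.mk_lift, key]
    simp only [torusMk, hsmul, ← AddCircle.coe_sub, ← AddCircle.coe_neg, circleMapOfDisp_coe]
    have hx : v.2 - Q * (v.1 - f v.2 / Q - g (v.2 - Q * v.1 + f v.2) / Q) =
        v.2 - Q * v.1 + f v.2 + g (v.2 - Q * v.1 + f v.2) := by field_simp; ring
    have hy : -(Q * (v.1 - f v.2 / Q - g (v.2 - Q * v.1 + f v.2) / Q)) =
        -(Q * v.1 - f v.2 - g (v.2 - Q * v.1 + f v.2)) := by field_simp
    rw [hx, hfg, hy]
    congr 1; ring
  · obtain ⟨v, rfl⟩ := torusMk_surjective z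
    rw [← h.mk_lift, key]
    simp only [torusMk, ← AddCircle.coe_sub]
    refine (unitAddCircle_norm_coe_le _).trans ?_
    have h1 := abs_le.1 (hfb v.2)
    have h2 := abs_le.1 (hgb (v.2 - Q * v.1 + f v.2))
    rw [show v.1 - f v.2 / Q - g (v.2 - Q * v.1 + f v.2) / Q - v.1 =
      (-f v.2 - g (v.2 - Q * v.1 + f v.2)) / Q by ring, abs_div, abs_of_pos hQ'']
    gcongr
    rw [abs_le]
    constructor <;> linarith
  · obtain ⟨x, hx, rfl⟩ := exists_abs_le_half a
    rw [norm_sub_half hx] at ha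
    rw [circleMapOfDisp_coe]
    exact (unitAddCircle_norm_coe_le _).trans (hconc x (by linarith))

namespace IsQuasiRotation

variable {Q : ℕ} {η : ℝ} {h : TorusDiffeo} {F : UnitAddCircle → UnitAddCircle}

/-- This invariance of `y = 0` under every conjugating map survives in the limit and is the source
of the non-generic circle. -/
lemma snd_eq_zero_iff (hR : IsQuasiRotation Q η h F) (z : Torus) :
    (h.toPerm z).2 = 0 ↔ z.2 = 0 := by
  rw [hR.snd_eq, sub_eq_zero, hR.injective.eq_iff, sub_eq_neg_self]

/-- Away from a short arc the image of a horizontal circle is close to a line. -/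
lemma norm_snd_sub_le (hR : IsQuasiRotation Q η h F) {z : Torus}
    (hu : η < ‖F z.2 - Q • z.1‖) (hs : 2 * η ≤ ‖z.2‖) :
    ‖(h.toPerm z).2 - (F z.2 - Q • z.1)‖ ≤ η := by
  set c := ((1 / 2 : ℝ) : UnitAddCircle)
  rw [hR.snd_eq, hR.map_sub, sub_sub_cancel_left, norm_neg]
  apply hR.norm_map_le
  -- `F` takes a value outside the `η`-ball only on the `η`-ball around `1/2`. So `z.2 - Q x'` is
  -- near `1/2`, hence `-Q x'` is not, and the term `F (-Q x')` is at most `η`.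
  have h1 : ‖z.2 - Q • (h.toPerm z).1 - c‖ < η := by
    by_contra! hlt
    have := hR.norm_map_le _ hlt
    rw [hR.map_sub] at this
    linarith
  have h2 : ‖z.2‖ ≤ ‖z.2 - Q • (h.toPerm z).1 - c‖ + ‖-(Q • (h.toPerm z).1) - c‖ := by
    refine le_trans (le_of_eq ?_) (norm_sub_le _ _)
    congr 1; abel
  linarith

/-- Away from vertical strips the image of a point determines the parameter on the line. -/
lemma norm_sub_snd_le (hR : IsQuasiRotation Q η h F) {z : Torus}
    (hx : η ≤ ‖-(Q • (h.toPerm z).1) - ((1 / 2 : ℝ) : UnitAddCircle)‖) :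
    ‖(F z.2 - Q • z.1) - (h.toPerm z).2‖ ≤ η := by
  rw [hR.snd_eq, hR.map_sub, sub_sub_cancel]
  exact hR.norm_map_le _ hx

/-- If `z.2` were small, then `z.2 - Q x'` and `-Q x'` would both be far from `1/2`. Both values of
`F` would lie in the `η`-ball, forcing the image height below `2 η < κ`. -/
lemma le_norm_snd (hR : IsQuasiRotation Q η h F) {z : Torus} {κ : ℝ} (hκ : 2 * η < κ)
    (hx : κ < ‖-(Q • (h.toPerm z).1) - ((1 / 2 : ℝ) : UnitAddCircle)‖)
    (hy : κ < ‖(h.toPerm z).2‖) : κ / 2 ≤ ‖z.2‖ := by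
  set c := ((1 / 2 : ℝ) : UnitAddCircle)
  by_contra! hs
  have h2 : ‖-(Q • (h.toPerm z).1) - c‖ ≤ ‖z.2 - Q • (h.toPerm z).1 - c‖ + ‖z.2‖ := by
    refine le_trans (le_of_eq ?_) (norm_sub_le _ _)
    congr 1; abel
  have h3 := hR.norm_map_le (z.2 - Q • (h.toPerm z).1) (by linarith)
  have hη : 0 ≤ η := (norm_nonneg _).trans h3
  have h4 := hR.norm_map_le (-(Q • (h.toPerm z).1)) (by linarith)
  rw [hR.snd_eq] at hy
  linarith [norm_sub_le (F (z.2 - Q • (h.toPerm z).1)) (F (-(Q • (h.toPerm z).1)))]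

end IsQuasiRotation

/-! ### Smooth estimates for conjugated rotations and smooth limits. -/

section Periodic

variable {E : Type*} [NormedAddCommGroup E]

lemma exists_int_add_mem_unitSquare (v : ℝ × ℝ) :
    ∃ w ∈ Set.Icc (0 : ℝ × ℝ) 1, ∃ m n : ℤ, v = w + ((m : ℝ), (n : ℝ)) := by
  refine ⟨(Int.fract v.1, Int.fract v.2), ⟨⟨Int.fract_nonneg _, Int.fract_nonneg _⟩,
    ⟨(Int.fract_lt_one _).le, (Int.fract_lt_one _).le⟩⟩, ⌊v.1⌋, ⌊v.2⌋, ?_⟩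
  ext <;> simp

lemma exists_norm_le_of_periodic {G : ℝ × ℝ → E} (hG : Continuous G)
    (hp : ∀ v (m n : ℤ), G (v + ((m : ℝ), (n : ℝ))) = G v) : ∃ C, ∀ v, ‖G v‖ ≤ C := by
  obtain ⟨C, hC⟩ := (isCompact_Icc (a := (0 : ℝ × ℝ)) (b := 1)).exists_bound_of_continuousOn
    hG.continuousOn
  refine ⟨C, fun v => ?_⟩
  obtain ⟨w, hw, m, n, rfl⟩ := exists_int_add_mem_unitSquare v
  rw [hp]
  exact hC w hw

/-- Periodicity reduces uniformity over the plane to the compact unit square, where the tube lemma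
applies. -/
lemma eventually_norm_lt_of_periodic {G : ℝ → ℝ × ℝ → E} (hG : Continuous (Function.uncurry G))
    (hp : ∀ t v (m n : ℤ), G t (v + ((m : ℝ), (n : ℝ))) = G t v) {t₀ : ℝ} (h0 : ∀ v, G t₀ v = 0)
    {ε : ℝ} (hε : 0 < ε) : ∀ᶠ t in 𝓝 t₀, ∀ v, ‖G t v‖ < ε := by
  have h := (isCompact_Icc (a := (0 : ℝ × ℝ)) (b := 1)).eventually_forall_of_forall_eventually
    (x₀ := t₀) (P := fun t v => ‖G t v‖ < ε) fun v _ => by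
      refine (hG.norm.tendsto (t₀, v)).eventually (gt_mem_nhds ?_)
      simpa [Function.uncurry, h0] using hε
  filter_upwards [h] with t ht v
  obtain ⟨w, hw, m, n, rfl⟩ := exists_int_add_mem_unitSquare v
  rw [hp]
  exact ht w hw

lemma iteratedFDeriv_periodic {F : Type*} [NormedAddCommGroup F] [NormedSpace ℝ F]
    {G : ℝ × ℝ → F} (hp : ∀ v (m n : ℤ), G (v + ((m : ℝ), (n : ℝ))) = G v) (k : ℕ) (v : ℝ × ℝ)
    (m n : ℤ) : iteratedFDeriv ℝ k G (v + ((m : ℝ), (n : ℝ))) = iteratedFDeriv ℝ k G v := by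
  rw [← iteratedFDeriv_comp_add_right]
  simp only [hp]

end Periodic

lemma ContDiff.iteratedFDeriv_param {E F G : Type*} [NormedAddCommGroup E] [NormedSpace ℝ E]
    [NormedAddCommGroup F] [NormedSpace ℝ F] [NormedAddCommGroup G] [NormedSpace ℝ G]
    {Φ : E → F → G} (h : ContDiff ℝ ∞ (Function.uncurry Φ)) (k : ℕ) :
    ContDiff ℝ ∞ (Function.uncurry fun t v => iteratedFDeriv ℝ k (Φ t) v) := by
  induction k with
  | zero =>
    simp only [iteratedFDeriv_zero_eq_comp]
    exact ((continuousMultilinearCurryFin0 ℝ F G).symm.contDiff).comp h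
  | succ k ih =>
    simp only [iteratedFDeriv_succ_eq_comp_left]
    refine ((continuousMultilinearCurryLeftEquiv ℝ (fun _ : Fin (k + 1) => F) G).symm.contDiff).comp
      (?_ : ContDiff ℝ ∞ fun p : E × F => fderiv ℝ (iteratedFDeriv ℝ k (Φ p.1)) p.2)
    exact ContDiff.fderiv (m := ∞) (f := fun (p : E × F) w => iteratedFDeriv ℝ k (Φ p.1) w)
      (ih.comp (by fun_prop : ContDiff ℝ ∞ fun q : (E × F) × F => (q.1.1, q.2))) contDiff_snd
      (by simp)

namespace TorusDiffeo

/-- The lift of `h ∘ S_t ∘ h⁻¹`. -/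
def conjLift (h : TorusDiffeo) (t : ℝ) (v : ℝ × ℝ) : ℝ × ℝ := h.lift (h.lift.symm v + (t, 0))

lemma contDiff_conjLift_uncurry (h : TorusDiffeo) : ContDiff ℝ ∞ (Function.uncurry h.conjLift) := by
  have h1 := h.contDiff_lift
  have h2 := h.contDiff_symm
  unfold conjLift Function.uncurry
  fun_prop

lemma contDiff_conjLift (h : TorusDiffeo) (t : ℝ) : ContDiff ℝ ∞ (h.conjLift t) :=
  h.contDiff_conjLift_uncurry.comp (by fun_prop : ContDiff ℝ ∞ fun v : ℝ × ℝ => (t, v))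

lemma conjLift_add (h : TorusDiffeo) (t : ℝ) (v : ℝ × ℝ) (m n : ℤ) :
    h.conjLift t (v + ((m : ℝ), (n : ℝ))) = h.conjLift t v + ((m : ℝ), (n : ℝ)) := by
  rw [conjLift, symm_add, add_right_comm, lift_add, conjLift]

lemma conjLift_conjLift (h : TorusDiffeo) (s t : ℝ) (v : ℝ × ℝ) :
    h.conjLift s (h.conjLift t v) = h.conjLift (t + s) v := by
  simp [conjLift, add_assoc]

lemma conjLift_zero (h : TorusDiffeo) (v : ℝ × ℝ) : h.conjLift 0 v = v := by
  simp [conjLift, ← Prod.zero_eq_mk]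

lemma mk_conjLift (h : TorusDiffeo) (t : ℝ) (v : ℝ × ℝ) :
    torusMk (h.conjLift t v) =
      (h.toPerm * circleAction (t : UnitAddCircle) * h.toPerm⁻¹) (torusMk v) := by
  rw [conjLift, mk_lift, torusMk_add, mk_symm]
  simp only [Equiv.Perm.coe_mul, Function.comp, circleAction, Equiv.coe_fn_mk, torusMk,
    Equiv.Perm.inv_def]
  congr 1
  ext <;> simp

/-- With the conjugating map fixed, a small enough change of the angle is invisible in any
prescribed number of derivatives. This is what makes a large `K` give convergence. -/
lemma eventually_conjLift_close (h : TorusDiffeo) (k : ℕ) (t₀ : ℝ) {ε : ℝ} (hε : 0 < ε) :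
    ∀ᶠ t in 𝓝 t₀, ∀ v,
      ‖iteratedFDeriv ℝ k (fun v => h.conjLift t v - h.conjLift t₀ v) v‖ < ε := by
  have hs : ContDiff ℝ ∞ (Function.uncurry fun t v => h.conjLift t v - h.conjLift t₀ v) :=
    h.contDiff_conjLift_uncurry.sub ((h.contDiff_conjLift t₀).comp contDiff_snd)
  refine eventually_norm_lt_of_periodic (hs.iteratedFDeriv_param k).continuous
    (fun t v m n => iteratedFDeriv_periodic (fun v m n => ?_) k v m n) (fun v => ?_) hε
  · simp only [conjLift_add, add_sub_add_right_eq_sub]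
  · simp only [sub_self]
    exact congrFun iteratedFDeriv_fun_zero v

lemma dist_torusMk_le (v w : ℝ × ℝ) : dist (torusMk v) (torusMk w) ≤ dist v w := by
  simp only [torusMk, dist_eq_norm]
  exact max_le_max (unitAddCircle_norm_coe_le _) (unitAddCircle_norm_coe_le _)

lemma exists_lipschitzWith (h : TorusDiffeo) : ∃ L : ℕ, LipschitzWith L h.toPerm := by
  have hp : ∀ v (m n : ℤ), fderiv ℝ h.lift (v + ((m : ℝ), (n : ℝ))) = fderiv ℝ h.lift v := by
    intro v m n
    rw [← fderiv_comp_add_right]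
    simp only [h.lift_add, fderiv_add_const]
  obtain ⟨C, hC⟩ := exists_norm_le_of_periodic (h.contDiff_lift.continuous_fderiv (by simp)) hp
  obtain ⟨L, hL⟩ := exists_nat_ge C
  refine ⟨L, LipschitzWith.of_dist_le_mul fun z w => ?_⟩
  have hlip : LipschitzWith (L : NNReal) h.lift :=
    lipschitzWith_of_nnnorm_fderiv_le (h.contDiff_lift.differentiable (by simp))
      fun v => by
        rw [← NNReal.coe_le_coe]
        simpa using (hC v).trans hL
  obtain ⟨v, rfl⟩ := torusMk_surjective w
  obtain ⟨a, ha, ha'⟩ := exists_abs_le_half (z.1 - v.1)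
  obtain ⟨b, hb, hb'⟩ := exists_abs_le_half (z.2 - v.2)
  have hz : z = torusMk (v + (a, b)) := by
    rw [torusMk_add]
    ext <;> simp [torusMk, ha', hb']
  have hd : dist z (torusMk v) = dist (v + (a, b)) v := by
    rw [Prod.dist_eq, dist_eq_norm, dist_eq_norm]
    simp only [torusMk]
    rw [← ha', ← hb', unitAddCircle_norm_coe_eq ha, unitAddCircle_norm_coe_eq hb]
    simp [Prod.norm_def]
  rw [hd, hz, ← mk_lift, ← mk_lift]
  exact (dist_torusMk_le _ _).trans (hlip.dist_le_mul _ _)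

end TorusDiffeo

/-- A sequence of lifts whose increments are small in the `C^∞` sense converges. -/
lemma exists_smooth_limit {Gs : ℕ → ℝ × ℝ → ℝ × ℝ} (hs : ∀ n, ContDiff ℝ ∞ (Gs n))
    (hp : ∀ N v (m n : ℤ), Gs N (v + ((m : ℝ), (n : ℝ))) = Gs N v + ((m : ℝ), (n : ℝ)))
    (hd : ∀ n, ∀ k ≤ n, ∀ v,
      ‖iteratedFDeriv ℝ k (fun v => Gs (n + 1) v - Gs n v) v‖ ≤ (1 / 2 : ℝ) ^ n) :
    ∃ G : ℝ × ℝ → ℝ × ℝ, ContDiff ℝ ∞ G ∧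
      (∀ k : ℕ, TendstoUniformly (fun n => iteratedFDeriv ℝ k (Gs n)) (iteratedFDeriv ℝ k G)
        atTop) := by
  set f : ℕ → ℝ × ℝ → ℝ × ℝ := fun n v => Gs (n + 1) v - Gs n v with hf
  have hfs : ∀ n, ContDiff ℝ ∞ (f n) := fun n => (hs (n + 1)).sub (hs n)
  have hB : ∀ k n : ℕ, ∃ C, ∀ v, ‖iteratedFDeriv ℝ k (f n) v‖ ≤ C := fun k n =>
    exists_norm_le_of_periodic ((hfs n).continuous_iteratedFDeriv (by exact_mod_cast le_top))
      (iteratedFDeriv_periodic (fun v a b => by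
        simp only [hf, hp, add_sub_add_right_eq_sub]) k)
  choose B hB using hB
  -- The geometric bound on the `k`-th derivative starts only at `n = k`. The finitely many earlier
  -- terms are bounded by periodicity, which does not affect summability.
  let u : ℕ → ℕ → ℝ := fun k n => if k ≤ n then (1 / 2 : ℝ) ^ n else B k n
  have hu : ∀ k, Summable (u k) := fun k => by
    refine (summable_congr_cofinite ?_).1 summable_geometric_two
    rw [Nat.cofinite_eq_atTop]
    filter_upwards [eventually_ge_atTop k] with n hn
    simp [u, hn]
  have hfu : ∀ k n v, ‖iteratedFDeriv ℝ k (f n) v‖ ≤ u k n := fun k n v => by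
    by_cases hk : k ≤ n
    · simpa [u, hk] using hd n k hk v
    · simpa [u, hk] using hB k n v
  have hsum : ContDiff ℝ ∞ fun v => ∑' n, f n v :=
    contDiff_tsum hfs (fun k _ => hu k) fun k n v _ => hfu k n v
  refine ⟨fun v => Gs 0 v + ∑' n, f n v, (hs 0).add hsum, fun k => ?_⟩
  have hk : ((k : ℕ∞) : WithTop ℕ∞) ≤ ∞ := by exact_mod_cast le_top
  have h1 : ∀ N, iteratedFDeriv ℝ k (Gs N) =
      fun v => iteratedFDeriv ℝ k (Gs 0) v +
        ∑ n ∈ Finset.range N, iteratedFDeriv ℝ k (f n) v := by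
    intro N
    induction N with
    | zero => simp
    | succ N ih =>
      have : Gs (N + 1) = Gs N + f N := by ext v <;> simp [hf]
      funext v
      rw [this, iteratedFDeriv_add_apply ((hs N).contDiffAt.of_le hk)
        ((hfs N).contDiffAt.of_le hk), ih, Finset.sum_range_succ, add_assoc]
  have h2 : iteratedFDeriv ℝ k (fun v => Gs 0 v + ∑' n, f n v) =
      fun v => iteratedFDeriv ℝ k (Gs 0) v + ∑' n, iteratedFDeriv ℝ k (f n) v := by
    funext v
    rw [← iteratedFDeriv_tsum_apply hfs (fun k _ => hu k) (fun k n v _ => hfu k n v)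
      (by exact_mod_cast le_top)]
    exact iteratedFDeriv_add_apply ((hs 0).contDiffAt.of_le hk) (hsum.contDiffAt.of_le hk)
  rw [h2, funext h1]
  have h3 := tendstoUniformly_tsum_nat (hu k) (hfu k)
  rw [Metric.tendstoUniformly_iff] at h3 ⊢
  simpa only [dist_add_left] using h3

/-! ### Equidistribution along periodic orbits, drifting orbits and steep lines. -/

lemma nsmul_coe_div_self {Q : ℕ} (hQ : 0 < Q) (p : ℤ) :
    Q • (((p : ℝ) / Q : ℝ) : UnitAddCircle) = 0 := by
  rw [← AddCircle.coe_nsmul, nsmul_eq_mul, mul_div_cancel₀ _ (by positivity)]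
  exact unitAddCircle_coe_intCast p

/-- The sum over a finite orbit is invariant. -/
lemma periodic_sum_orbit {Q : ℕ} {ρ : UnitAddCircle} (hρ : Q • ρ = 0) (f : UnitAddCircle → ℝ) :
    Function.Periodic (fun x => ∑ r ∈ Finset.range Q, f (x + r • ρ)) ρ := by
  intro x
  have h1 := Finset.sum_range_succ (fun r => f (x + r • ρ)) Q
  have h2 := Finset.sum_range_succ' (fun r => f (x + r • ρ)) Q
  simp only [hρ, zero_smul] at h1 h2
  rw [h1] at h2
  change ∑ r ∈ Finset.range Q, f (x + ρ + r • ρ) = ∑ r ∈ Finset.range Q, f (x + r • ρ)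
  rw [add_left_injective _ h2]
  refine Finset.sum_congr rfl fun r _ => ?_
  rw [add_smul, one_smul, add_assoc, add_comm ρ]

/-- The sum over a full periodic orbit of a rational rotation approximates the integral. -/
lemma abs_sum_orbit_sub_integral_le {Q : ℕ} (hQ : 0 < Q) {p : ℤ} (hp : IsCoprime p (Q : ℤ))
    {f : UnitAddCircle → ℝ} {Λ : NNReal} (hf : LipschitzWith Λ f) (x : UnitAddCircle) :
    |∑ r ∈ Finset.range Q, f (x + r • (((p : ℝ) / Q : ℝ) : UnitAddCircle)) - Q * ∫ y, f y| ≤ Λ := by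
  set ρ : UnitAddCircle := (((p : ℝ) / Q : ℝ) : UnitAddCircle) with hρ
  have hQ' : (0 : ℝ) < Q := by positivity
  set G : UnitAddCircle → ℝ := fun x => ∑ r ∈ Finset.range Q, f (x + r • ρ) with hG
  have hper : Function.Periodic G ρ := periodic_sum_orbit (nsmul_coe_div_self hQ p) f
  obtain ⟨a, b, hab⟩ := hp
  have haρ : a • ρ = ((1 / Q : ℝ) : UnitAddCircle) := by
    rw [hρ, ← AddCircle.coe_zsmul, ← sub_eq_zero, ← AddCircle.coe_sub]
    have : a • ((p : ℝ) / Q) - 1 / Q = ((-b : ℤ) : ℝ) := by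
      have h : (a : ℝ) * p + b * Q = 1 := by exact_mod_cast hab
      rw [zsmul_eq_mul]
      field_simp
      push_cast
      linarith
    rw [this]
    exact unitAddCircle_coe_intCast _
  -- Coprimality enters here: the orbit of `p/Q` consists of all multiples of `1/Q`, so `G` has
  -- period `1/Q`. Its Lipschitz constant is `Q Λ`, and its oscillation is therefore at most `Λ`.
  have hper' : Function.Periodic G ((1 / Q : ℝ) : UnitAddCircle) := haρ ▸ hper.zsmul a
  have hGlip : ∀ y z, |G y - G z| ≤ Q * (Λ * ‖y - z‖) := by
    intro y z
    rw [hG, ← Finset.sum_sub_distrib]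
    refine (Finset.abs_sum_le_sum_abs _ _).trans ?_
    refine (Finset.sum_le_card_nsmul _ _ (Λ * ‖y - z‖) fun r _ => ?_).trans (by simp)
    simpa [Real.dist_eq, dist_eq_norm] using hf.dist_le_mul (y + r • ρ) (z + r • ρ)
  have hosc : ∀ y z, |G y - G z| ≤ Λ := by
    intro y z
    obtain ⟨d, hd⟩ := QuotientAddGroup.mk_surjective (y - z)
    have hd' : (d : UnitAddCircle) = y - z := hd
    have h1 : G (y - round (Q * d) • ((1 / Q : ℝ) : UnitAddCircle)) = G y := hper'.sub_zsmul_eq _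
    rw [← h1]
    refine (hGlip _ _).trans ?_
    have h2 : y - round (Q * d) • ((1 / Q : ℝ) : UnitAddCircle) - z =
        ((d - round (Q * d) / Q : ℝ) : UnitAddCircle) := by
      rw [← AddCircle.coe_zsmul, zsmul_eq_mul, mul_one_div, AddCircle.coe_sub, hd']
      abel
    have h3 : ‖y - round (Q * d) • ((1 / Q : ℝ) : UnitAddCircle) - z‖ ≤ 1 / Q := by
      rw [h2]
      refine (unitAddCircle_norm_coe_le _).trans ?_
      have : d - round (Q * d) / Q = (Q * d - round (Q * d)) / Q := by field_simp
      rw [this, abs_div, abs_of_pos hQ']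
      gcongr
      linarith [abs_sub_round (Q * d : ℝ)]
    calc (Q : ℝ) * (Λ * _) ≤ Q * (Λ * (1 / Q)) := by gcongr
      _ = Λ := by field_simp
  have hint : ∀ r : ℕ, Integrable fun y : UnitAddCircle => f (y + r • ρ) := fun r =>
    (hf.continuous.comp (continuous_add_const _)).integrable_of_hasCompactSupport
      (HasCompactSupport.of_compactSpace _)
  have hGi : Integrable G := integrable_finsetSum _ fun r _ => hint r
  have hGint : ∫ y, G y = Q * ∫ y, f y := by
    rw [hG, integral_finsetSum _ fun r _ => hint r]
    simp [integral_add_right_eq_self f]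
  rw [← hGint]
  have : G x - ∫ y, G y = ∫ y, (G x - G y) := by
    rw [integral_sub (integrable_const _) hGi]
    simp
  change |G x - ∫ y, G y| ≤ Λ
  rw [this, ← Real.norm_eq_abs]
  refine (norm_integral_le_of_norm_le_const (C := Λ)
    (Eventually.of_forall fun y => hosc x y)).trans (by simp)

/-- Along a slowly drifting periodic rotation, orbit sums are close to the sums of the averages over
the periodic orbits. -/
lemma abs_sum_drift_le {Q : ℕ} {ρ σ : UnitAddCircle} (hρ : Q • ρ = 0)
    {f : UnitAddCircle → ℝ} {Λ : NNReal} (hf : LipschitzWith Λ f) {C : ℝ} (hC : ∀ x, |f x| ≤ C)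
    (t : UnitAddCircle) (N : ℕ) :
    |Q * ∑ i ∈ Finset.range N, f (t + i • (ρ + σ)) -
      ∑ i ∈ Finset.range N, ∑ r ∈ Finset.range Q, f (t + i • σ + r • ρ)| ≤
      Q * (N * (Λ * (Q * ‖σ‖)) + 2 * Q * C) := by
  -- The inner orbit sum may start at index `i`. Each residue `r` then compares the orbit shifted by
  -- `r` steps with the same terms lacking the drift `r • σ`; the shift costs only boundary terms.
  have hinv : ∀ i : ℕ, ∑ r ∈ Finset.range Q, f (t + i • σ + r • ρ) =
      ∑ r ∈ Finset.range Q, f (t + i • σ + (i + r) • ρ) := fun i => by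
    have h1 := (periodic_sum_orbit hρ f).nsmul i (t + i • σ)
    rw [← h1]
    refine Finset.sum_congr rfl fun r _ => ?_
    rw [add_smul, add_assoc]
  have hC0 : 0 ≤ C := (abs_nonneg _).trans (hC 0)
  have hshift : ∀ (b : ℕ → ℝ), (∀ i, |b i| ≤ C) → ∀ r : ℕ,
      |∑ i ∈ Finset.range N, b i - ∑ i ∈ Finset.range N, b (i + r)| ≤ 2 * r * C := by
    intro b hb r
    have h1 := Finset.sum_range_add b N r
    have h2 := Finset.sum_range_add b r N
    rw [add_comm r N, h1] at h2
    have h3 : ∑ i ∈ Finset.range N, b i - ∑ i ∈ Finset.range N, b (i + r) =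
        ∑ i ∈ Finset.range r, b i - ∑ i ∈ Finset.range r, b (N + i) := by
      simp only [add_comm _ r]
      linarith
    rw [h3]
    have h4 : ∀ c : ℕ → ℝ, (∀ i, |c i| ≤ C) → |∑ i ∈ Finset.range r, c i| ≤ r * C := fun c hc =>
      (Finset.abs_sum_le_sum_abs _ _).trans
        ((Finset.sum_le_card_nsmul _ _ C fun i _ => hc i).trans (by simp))
    have h5 := abs_le.1 (h4 b hb)
    have h6 := abs_le.1 (h4 (fun i => b (N + i)) fun i => hb _)
    rw [abs_le]
    constructor <;> linarith
  have hr : ∀ r ∈ Finset.range Q, |∑ i ∈ Finset.range N, f (t + i • (ρ + σ)) -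
      ∑ i ∈ Finset.range N, f (t + i • σ + (i + r) • ρ)| ≤
      N * (Λ * (Q * ‖σ‖)) + 2 * Q * C := by
    intro r hr
    have hrQ : (r : ℝ) ≤ Q := by exact_mod_cast (Finset.mem_range.1 hr).le
    have h1 := hshift (fun i => f (t + i • (ρ + σ))) (fun i => hC _) r
    have h2 : |∑ i ∈ Finset.range N, f (t + (i + r) • (ρ + σ)) -
        ∑ i ∈ Finset.range N, f (t + i • σ + (i + r) • ρ)| ≤ N * (Λ * (Q * ‖σ‖)) := by
      rw [← Finset.sum_sub_distrib]
      refine (Finset.abs_sum_le_sum_abs _ _).trans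
        ((Finset.sum_le_card_nsmul _ _ (Λ * (Q * ‖σ‖)) fun i _ => ?_).trans (by simp))
      have h3 := hf.dist_le_mul (t + (i + r) • (ρ + σ)) (t + i • σ + (i + r) • ρ)
      have h4 : t + (i + r) • (ρ + σ) - (t + i • σ + (i + r) • ρ) = r • σ := by
        rw [smul_add, add_smul i r σ]; abel
      rw [Real.dist_eq, dist_eq_norm, h4] at h3
      refine h3.trans ?_
      gcongr
      exact norm_nsmul_le.trans (by gcongr)
    calc _ ≤ _ + _ := abs_sub_le _ (∑ i ∈ Finset.range N, f (t + (i + r) • (ρ + σ))) _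
      _ ≤ 2 * r * C + N * (Λ * (Q * ‖σ‖)) := add_le_add h1 h2
      _ ≤ _ := by rw [add_comm]; gcongr
  have hsum : Q * ∑ i ∈ Finset.range N, f (t + i • (ρ + σ)) -
      ∑ i ∈ Finset.range N, ∑ r ∈ Finset.range Q, f (t + i • σ + r • ρ) =
      ∑ r ∈ Finset.range Q, (∑ i ∈ Finset.range N, f (t + i • (ρ + σ)) -
        ∑ i ∈ Finset.range N, f (t + i • σ + (i + r) • ρ)) := by
    rw [Finset.sum_sub_distrib, Finset.sum_const, Finset.card_range, nsmul_eq_mul,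
      Finset.sum_congr rfl fun i _ => hinv i, Finset.sum_comm]
  rw [hsum]
  exact (Finset.abs_sum_le_sum_abs _ _).trans
    ((Finset.sum_le_card_nsmul _ _ _ hr).trans (by rw [Finset.card_range, nsmul_eq_mul]))

/-- An orbit of a slow rotation that starts far from `0` spends little time close to `0`. -/
lemma card_visits_mul_le {M c R N : ℕ} (hM : 0 < M) {u : UnitAddCircle} {j d : ℝ}
    (hc : 2 * j < c / M) (hd : R * (c / M : ℝ) + j < d) (hu : d ≤ ‖u‖) :
    ((Finset.range N).filter
      fun i : ℕ => ‖u - i • ((1 / M : ℝ) : UnitAddCircle)‖ ≤ j).card * (R + 1) ≤ N := by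
  have hd2 : d ≤ 1 / 2 := hu.trans (by simpa using AddCircle.norm_le_half_period (1 : ℝ) one_ne_zero)
  have hM' : (0 : ℝ) < M := by positivity
  have hsm : ∀ i : ℕ, i • ((1 / M : ℝ) : UnitAddCircle) = ((i / M : ℝ) : UnitAddCircle) :=
    fun i => by rw [← AddCircle.coe_nsmul, nsmul_eq_mul, mul_one_div]
  simp only [hsm]
  set I := (Finset.range N).filter fun i : ℕ => ‖u - ((i / M : ℝ) : UnitAddCircle)‖ ≤ j
  -- The rotation needs more than `R c` steps to get from `u` into the `j`-ball, so shifting a visit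
  -- back by `k c` steps keeps the time nonnegative.
  have hle : ∀ i ∈ I, ∀ k ≤ R, k * c ≤ i := by
    intro i hi k hk
    by_contra! hlt
    have hij := (Finset.mem_filter.1 hi).2
    have h1 : ‖u‖ ≤ ‖u - ((i / M : ℝ) : UnitAddCircle)‖ + ‖((i / M : ℝ) : UnitAddCircle)‖ :=
      norm_le_norm_sub_add u _
    have h2 := unitAddCircle_norm_coe_le (i / M : ℝ)
    rw [abs_of_nonneg (by positivity)] at h2
    have h3 : (i / M : ℝ) ≤ R * (c / M) := by
      rw [← mul_div_assoc]
      gcongr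
      exact_mod_cast hlt.le.trans (Nat.mul_le_mul_right c hk)
    linarith
  -- Times differing by `(k' - k) c` are separated by more than `2 j` but less than half a turn, so
  -- both cannot be visits. Thus the `R + 1` shifted copies of the visit set are disjoint subsets of
  -- `range N`.
  have hinj : ∀ i ∈ I, ∀ i' ∈ I, ∀ k ≤ R, ∀ k' ≤ R, i - k * c = i' - k' * c → ¬ k < k' := by
    intro i hi i' hi' k hk k' hk' heq hlt
    have h1 := hle i hi k hk
    have h2 := hle i' hi' k' hk'
    have h3 : (i' : ℝ) = i + (k' - k) * c := by
      have : i' + k * c = i + k' * c := by omega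
      have : (i' : ℝ) + k * c = i + k' * c := by exact_mod_cast this
      linarith
    have hkk : (1 : ℝ) ≤ k' - k := by
      have : (k : ℝ) + 1 ≤ k' := by exact_mod_cast hlt
      linarith
    have hkR : (k' : ℝ) - k ≤ R := by
      have h4 : (k' : ℝ) ≤ R := by exact_mod_cast hk'
      linarith [(Nat.cast_nonneg k : (0 : ℝ) ≤ k)]
    have hpos : (0 : ℝ) ≤ c / M := by positivity
    have hi2 := (Finset.mem_filter.1 hi).2
    have hi2' := (Finset.mem_filter.1 hi').2
    have h5 : ‖((((k' : ℝ) - k) * (c / M) : ℝ) : UnitAddCircle)‖ ≤ 2 * j := by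
      have : ((((k' : ℝ) - k) * (c / M) : ℝ) : UnitAddCircle) =
          (u - ((i / M : ℝ) : UnitAddCircle)) - (u - ((i' / M : ℝ) : UnitAddCircle)) := by
        rw [sub_sub_sub_cancel_left, ← AddCircle.coe_sub, h3]
        congr 1
        ring
      rw [this]
      linarith [norm_sub_le (u - ((i / M : ℝ) : UnitAddCircle)) (u - ((i' / M : ℝ) : UnitAddCircle))]
    have h6 : (c / M : ℝ) ≤ ((k' : ℝ) - k) * (c / M) := le_mul_of_one_le_left hpos hkk
    have h7 : ((k' : ℝ) - k) * (c / M) ≤ R * (c / M) := mul_le_mul_of_nonneg_right hkR hpos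
    have hj : 0 ≤ j := (norm_nonneg _).trans hi2
    rw [unitAddCircle_norm_coe_eq (by rw [abs_of_nonneg (by linarith)]; linarith),
      abs_of_nonneg (by linarith)] at h5
    linarith
  rw [← Finset.card_range (R + 1), ← Finset.card_product]
  conv_rhs => rw [← Finset.card_range N]
  refine Finset.card_le_card_of_injOn (fun x => x.1 - x.2 * c) ?_ ?_
  · rintro ⟨i, k⟩ hik
    have := (Finset.mem_filter.1 (Finset.mem_product.1 hik).1).1
    simp only [Finset.coe_range, Set.mem_Iio, Finset.mem_range] at this ⊢
    omega
  · rintro ⟨i, k⟩ hik ⟨i', k'⟩ hik' heq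
    have h1 := Finset.mem_product.1 hik
    have h2 := Finset.mem_product.1 hik'
    simp only [Finset.mem_range] at h1 h2
    have hk : k ≤ R := by omega
    have hk' : k' ≤ R := by omega
    have ha := hinj i h1.1 i' h2.1 k hk k' hk' heq
    have hb := hinj i' h2.1 i h1.1 k' hk' k hk heq.symm
    have hkk : k = k' := by omega
    subst hkk
    have := hle i h1.1 k hk
    have := hle i' h2.1 k hk
    simp only at heq
    exact Prod.ext (by simp only; omega) rfl

lemma measurePreserving_sub_nsmul {Q : ℕ} (hQ : 0 < Q) (a : UnitAddCircle) :
    MeasurePreserving (fun t : UnitAddCircle => a - Q • t) volume volume := by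
  have h1 : MeasurePreserving (fun t : UnitAddCircle => (-(Q : ℤ)) • t) volume volume :=
    Measure.measurePreserving_zsmul volume (by omega)
  convert (measurePreserving_add_left volume a).comp h1 using 1
  funext t
  simp [sub_eq_add_neg]

lemma Continuous.integrable_of_compactSpace {X : Type*} [TopologicalSpace X] [CompactSpace X]
    [MeasurableSpace X] [OpensMeasurableSpace X] {μ : Measure X} [IsFiniteMeasure μ]
    {f : X → ℝ} (hf : Continuous f) : Integrable f μ :=
  hf.integrable_of_hasCompactSupport (HasCompactSupport.of_compactSpace _)

lemma measurePreserving_integral_comp {X : Type*} [MeasurableSpace X] {μ : Measure X} {u : X → X}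
    (hu : MeasurePreserving u μ μ) {f : X → ℝ} (hf : AEStronglyMeasurable f μ) :
    ∫ t, f (u t) ∂μ = ∫ t, f t ∂μ := by
  rw [← integral_map hu.measurable.aemeasurable (by rwa [hu.map_eq]), hu.map_eq]

/-- A steep closed line in the torus is equidistributed. -/
lemma abs_integral_line_sub_le {Q : ℕ} (hQ : 0 < Q) {ψ : Torus → ℝ} {Λ : NNReal}
    (hψ : LipschitzWith Λ ψ) (a : UnitAddCircle) :
    |(∫ t, ψ (t, a - Q • t)) - ∫ z, ψ z| ≤ Λ / Q := by
  have hQ' : (0 : ℝ) < Q := by positivity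
  set ρ : UnitAddCircle := ((((1 : ℤ) : ℝ) / Q : ℝ) : UnitAddCircle)
  have hρ : Q • ρ = 0 := nsmul_coe_div_self hQ 1
  -- The height `a - Q • t` is unchanged when `t` moves by `1/Q`. The line integral can therefore be
  -- averaged over `Q` horizontal translates, which form an orbit of the rotation by `1/Q`.
  have hshift : ∀ r : ℕ, ∫ t, ψ (t + r • ρ, a - Q • t) = ∫ t, ψ (t, a - Q • t) := fun r => by
    rw [← integral_add_right_eq_self (fun t => ψ (t, a - Q • t)) (r • ρ)]
    simp only [smul_add, smul_comm Q r, hρ, smul_zero, add_zero]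
  have hψi : Integrable ψ (volume.prod volume) := hψ.continuous.integrable_of_compactSpace
  have hΨ1 : Integrable fun y : UnitAddCircle => ∫ x, ψ (x, y) := hψi.swap.integral_prod_left
  have hmp := measurePreserving_sub_nsmul hQ a
  have hΨ : ∫ z, ψ z = ∫ t : UnitAddCircle, ∫ x, ψ (x, a - Q • t) := by
    rw [measurePreserving_integral_comp hmp hΨ1.aestronglyMeasurable]
    exact integral_prod_symm ψ hψi
  have hΨi : Integrable ((fun y : UnitAddCircle => ∫ x, ψ (x, y)) ∘ fun t => a - Q • t) :=
    (hmp.integrable_comp hΨ1.aestronglyMeasurable).2 hΨ1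
  simp only [Function.comp_def] at hΨi
  have hi2 : ∀ r : ℕ, Integrable fun t : UnitAddCircle => ψ (t + r • ρ, a - Q • t) :=
    fun r => (hψ.continuous.comp (by fun_prop)).integrable_of_compactSpace
  have hmul : (Q : ℝ) * ((∫ t, ψ (t, a - Q • t)) - ∫ z, ψ z) =
      ∫ t : UnitAddCircle,
        (∑ r ∈ Finset.range Q, ψ (t + r • ρ, a - Q • t) - Q * ∫ x, ψ (x, a - Q • t)) := by
    rw [integral_sub (integrable_finsetSum _ fun r _ => hi2 r) (hΨi.const_mul _),
      integral_finsetSum _ fun r _ => hi2 r, integral_const_mul, ← hΨ]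
    simp only [hshift, Finset.sum_const, Finset.card_range, nsmul_eq_mul]
    ring
  have hbound : |(Q : ℝ) * ((∫ t, ψ (t, a - Q • t)) - ∫ z, ψ z)| ≤ Λ := by
    rw [hmul, ← Real.norm_eq_abs]
    refine (norm_integral_le_of_norm_le_const (C := Λ)
      (Eventually.of_forall fun t => ?_)).trans (by simp)
    have hlip : LipschitzWith Λ fun x => ψ (x, a - Q • t) := by
      have := hψ.comp (LipschitzWith.prodMk_right (α := UnitAddCircle) (a - Q • t))
      rwa [mul_one] at this
    exact abs_sum_orbit_sub_integral_le hQ (p := 1) isCoprime_one_left hlip t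
  rw [abs_mul, abs_of_pos hQ'] at hbound
  rw [le_div_iff₀ hQ']
  linarith

/-- A quasi-rotation makes horizontal circles equidistributed. -/
lemma IsQuasiRotation.abs_integral_sub_le {Q : ℕ} (hQ : 0 < Q) {η : ℝ} (hη : 0 ≤ η)
    {h : TorusDiffeo} {F : UnitAddCircle → UnitAddCircle} (hR : IsQuasiRotation Q η h F)
    {ψ : Torus → ℝ} {Λ : NNReal} (hψ : LipschitzWith Λ ψ) {C : ℝ} (hC : ∀ z, |ψ z| ≤ C)
    {s : UnitAddCircle} (hs : 2 * η ≤ ‖s‖) :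
    |(∫ t, ψ (h.toPerm (t, s))) - ∫ z, ψ z| ≤ Λ * (2 / Q + η) + 4 * C * η := by
  have hQ' : (0 : ℝ) < Q := by positivity
  have hC0 : 0 ≤ C := (abs_nonneg _).trans (hC 0)
  obtain ⟨L, hL⟩ := h.exists_lipschitzWith
  set u : UnitAddCircle → UnitAddCircle := fun t => F s - Q • t with hu
  have huc : Continuous u := continuous_const.sub (continuous_nsmul Q)
  have hump : MeasurePreserving u volume volume := measurePreserving_sub_nsmul hQ (F s)
  have hstep1 : |(∫ t, ψ (h.toPerm (t, s))) - ∫ t, ψ (t, u t)| ≤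
      Λ * (1 / Q + η) + 4 * C * η := by
    -- The parameters where the image curve need not follow the line: measure at most `2 η` and an
    -- error of at most `2 C` there, whence the term `4 C η`.
    set B : Set UnitAddCircle := u ⁻¹' Metric.closedBall 0 η with hB
    have hBm : MeasurableSet B := huc.measurable Metric.isClosed_closedBall.measurableSet
    have hBv : volume.real B ≤ 2 * η := by
      rw [measureReal_def, hump.measure_preimage Metric.isClosed_closedBall.nullMeasurableSet,
        AddCircle.volume_closedBall]
      exact ENNReal.toReal_le_of_le_ofReal (by positivity)
        (ENNReal.ofReal_le_ofReal (min_le_right _ _))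
    have hi1 : Integrable fun t => ψ (h.toPerm (t, s)) :=
      (hψ.continuous.comp (hL.continuous.comp (by fun_prop))).integrable_of_compactSpace
    have hi2 : Integrable fun t => ψ (t, u t) := (hψ.continuous.comp (by fun_prop)).integrable_of_compactSpace
    rw [← integral_sub hi1 hi2]
    have hbound : ∀ t, ‖ψ (h.toPerm (t, s)) - ψ (t, u t)‖ ≤
        Λ * (1 / Q + η) + B.indicator (fun _ => 2 * C) t := by
      intro t
      by_cases ht : t ∈ B
      · rw [Set.indicator_of_mem ht, Real.norm_eq_abs]
        have h1 := abs_le.1 (hC (h.toPerm (t, s)))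
        have h2 := abs_le.1 (hC (t, u t))
        have h3 : 0 ≤ Λ * (1 / Q + η) := by positivity
        rw [abs_le]
        constructor <;> linarith
      · rw [Set.indicator_of_notMem ht, add_zero, ← dist_eq_norm]
        refine (hψ.dist_le_mul _ _).trans ?_
        gcongr
        have ht' : η < ‖u t‖ := by simpa [hB] using ht
        have h1 := hR.norm_snd_sub_le (z := (t, s)) ht' hs
        have h2 := hR.norm_fst_sub_le (t, s)
        rw [Prod.dist_eq, dist_eq_norm, dist_eq_norm]
        have : (0 : ℝ) ≤ 1 / Q := by positivity
        exact max_le (by linarith) (by simp only [hu]; linarith)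
    refine (norm_integral_le_of_norm_le (g := fun t =>
      Λ * (1 / Q + η) + B.indicator (fun _ => 2 * C) t) ?_ (Eventually.of_forall hbound)).trans ?_
    · exact (integrable_const _).add ((integrable_const _).indicator hBm)
    · rw [integral_add (integrable_const _) ((integrable_const _).indicator hBm),
        integral_indicator hBm]
      simp only [integral_const, probReal_univ, smul_eq_mul, measureReal_restrict_apply,
        MeasurableSet.univ, Set.univ_inter]
      nlinarith
  have hstep2 := abs_integral_line_sub_le hQ hψ (F s)
  calc _ ≤ _ + _ := abs_sub_le _ (∫ t, ψ (t, u t)) _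
    _ ≤ Λ * (1 / Q + η) + 4 * C * η + Λ / Q := add_le_add hstep1 hstep2
    _ = _ := by ring

namespace IsQuasiRotation

variable {Q : ℕ} {η : ℝ} {h : TorusDiffeo} {F : UnitAddCircle → UnitAddCircle}

lemma toPerm_add (hR : IsQuasiRotation Q η h F) (p : ℤ) (z : Torus) :
    h.toPerm (z.1 + (((p : ℝ) / Q : ℝ) : UnitAddCircle), z.2) =
      ((h.toPerm z).1 + (((p : ℝ) / Q : ℝ) : UnitAddCircle), (h.toPerm z).2) := by
  obtain ⟨v, rfl⟩ := torusMk_surjective z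
  have h1 := congrArg torusMk (hR.lift_comm v p)
  rw [h.mk_lift, torusMk_add, torusMk_add, h.mk_lift] at h1
  have h2 : ∀ a : Torus, a + torusMk ((p : ℝ) / Q, 0) =
      (a.1 + (((p : ℝ) / Q : ℝ) : UnitAddCircle), a.2) := fun a =>
    Prod.ext rfl (by simp [torusMk])
  rwa [h2, h2] at h1

lemma toPerm_add_nsmul (hR : IsQuasiRotation Q η h F) (p : ℤ) (r : ℕ) (z : Torus) :
    h.toPerm (z.1 + r • (((p : ℝ) / Q : ℝ) : UnitAddCircle), z.2) =
      ((h.toPerm z).1 + r • (((p : ℝ) / Q : ℝ) : UnitAddCircle), (h.toPerm z).2) := by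
  have h1 : r • (((p : ℝ) / Q : ℝ) : UnitAddCircle) =
      ((((r * p : ℤ) : ℝ) / Q : ℝ) : UnitAddCircle) := by
    rw [← AddCircle.coe_nsmul, nsmul_eq_mul]
    congr 1
    push_cast
    ring
  rw [h1]
  exact hR.toPerm_add _ z

end IsQuasiRotation

lemma lipschitzWith_slice {f : Torus → ℝ} {Λ : NNReal} (hf : LipschitzWith Λ f)
    (s : UnitAddCircle) : LipschitzWith Λ fun x => f (x, s) := by
  have := hf.comp (LipschitzWith.prodMk_right (α := UnitAddCircle) s)
  rwa [mul_one] at this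

/-- Averages over finite horizontal orbits after a quasi-rotation are close to the integral. -/
lemma IsQuasiRotation.abs_sum_horizontal_sub_le {Q₀ Q : ℕ} (hQ₀ : 0 < Q₀) (hQ : 0 < Q) {p : ℤ}
    (hp : IsCoprime p (Q : ℤ)) {η₀ : ℝ} (hη₀ : 0 ≤ η₀) {H₀ h₀ : TorusDiffeo}
    {F₀ : UnitAddCircle → UnitAddCircle} (hR₀ : IsQuasiRotation Q₀ η₀ h₀ F₀)
    {L₀ L : NNReal} (hL₀ : LipschitzWith L₀ H₀.toPerm)
    (hL : LipschitzWith L (H₀.mul h₀).toPerm) {φ : Torus → ℝ} {Λ : NNReal}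
    (hφ : LipschitzWith Λ φ) {C : ℝ} (hC : ∀ z, |φ z| ≤ C) {w : Torus} (hw : 2 * η₀ ≤ ‖w.2‖) :
    |∑ r ∈ Finset.range Q, φ ((H₀.mul h₀).toPerm
        (w.1 + r • (((p : ℝ) / Q : ℝ) : UnitAddCircle), w.2)) - Q * ∫ z, φ z| ≤
      Λ * L + Q * (Λ * L₀ * (2 / Q₀ + η₀) + 4 * C * η₀) := by
  have h1 := abs_sum_orbit_sub_integral_le hQ hp (lipschitzWith_slice (hφ.comp hL) w.2) w.1
  have h2 := hR₀.abs_integral_sub_le hQ₀ hη₀ (hφ.comp hL₀) (C := C) (fun z => hC _) hw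
  have h3 : ∫ z, (φ ∘ H₀.toPerm) z = ∫ z, φ z :=
    measurePreserving_integral_comp H₀.measurePreserving
      hφ.continuous.aestronglyMeasurable
  rw [h3] at h2
  simp only [Function.comp, NNReal.coe_mul] at h1 h2
  set I := ∫ t, φ (H₀.toPerm (h₀.toPerm (t, w.2))) with hI
  have hI' : ∫ y, φ ((H₀.mul h₀).toPerm (y, w.2)) = I := rfl
  rw [hI'] at h1
  calc _ ≤ _ + _ := abs_sub_le _ (Q * I) _
    _ ≤ _ := by
      refine add_le_add h1 ?_
      rw [← mul_sub, abs_mul, abs_of_nonneg (by positivity)]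
      gcongr

/-- The Birkhoff sums of a periodic approximation are close to the integral on the scale on which it
is not yet seen to be periodic. -/
lemma abs_birkhoffSum_approx_le {Q₀ Q K R : ℕ} (hQ₀ : 0 < Q₀) (hQ : 0 < Q) (hK : 0 < K) {p : ℤ}
    (hp : IsCoprime p (Q : ℤ)) {η₀ η κ₀ κ : ℝ} (hη₀ : 0 < η₀) (hη : 0 < η) (hηη₀ : η ≤ η₀)
    (hηκ : 4 * η ≤ κ) (hηκ₀ : 32 * (R + 1) * η₀ ≤ κ₀) (hKQ : 1 ≤ η₀ * (K * Q : ℕ))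
    {H₀ h₀ h : TorusDiffeo} {F₀ F : UnitAddCircle → UnitAddCircle}
    (hR₀ : IsQuasiRotation Q₀ η₀ h₀ F₀) (hR : IsQuasiRotation Q η h F)
    {L₀ L L' : NNReal} (hL₀ : LipschitzWith L₀ H₀.toPerm)
    (hL : LipschitzWith L (H₀.mul h₀).toPerm)
    (hL' : LipschitzWith L' ((H₀.mul h₀).mul h).toPerm) {φ : Torus → ℝ} {Λ : NNReal}
    (hφ : LipschitzWith Λ φ) {C : ℝ} (hC : ∀ z, |φ z| ≤ C) {z : Torus}
    (hx : κ < ‖-(Q • (h.toPerm z).1) - ((1 / 2 : ℝ) : UnitAddCircle)‖)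
    (hy : κ < ‖(h.toPerm z).2‖) (hy₀ : κ₀ / 2 ≤ ‖(h.toPerm z).2‖) (N : ℕ) :
    |∑ i ∈ Finset.range N, φ (((H₀.mul h₀).mul h).toPerm
        (z.1 + i • ((((p : ℝ) / Q : ℝ) : UnitAddCircle) +
          ((1 / (K * Q ^ 2) : ℝ) : UnitAddCircle)), z.2)) - N * ∫ z, φ z| ≤
      N * (Λ * L' / (K * Q)) + 2 * Q * C +
        N * (Λ * L / Q + (Λ * L₀ * (2 / Q₀ + η₀) + 4 * C * η₀)) + 2 * C * (N / (R + 1)) := by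
  have hQ' : (0 : ℝ) < Q := by positivity
  have hK' : (0 : ℝ) < K := by positivity
  have hC0 : 0 ≤ C := (abs_nonneg _).trans (hC 0)
  set ρ : UnitAddCircle := (((p : ℝ) / Q : ℝ) : UnitAddCircle) with hρdef
  set σ : UnitAddCircle := ((1 / (K * Q ^ 2) : ℝ) : UnitAddCircle) with hσdef
  have hρ : Q • ρ = 0 := nsmul_coe_div_self hQ p
  have hσ : ‖σ‖ ≤ 1 / (K * Q ^ 2) := by
    refine (unitAddCircle_norm_coe_le _).trans (le_of_eq (abs_of_nonneg (by positivity)))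
  have hQσ : Q • σ = ((1 / (K * Q : ℕ) : ℝ) : UnitAddCircle) := by
    rw [hσdef, ← AddCircle.coe_nsmul, nsmul_eq_mul]
    congr 1
    push_cast
    field_simp
  set w : ℕ → Torus := fun i => h.toPerm (z.1 + i • σ, z.2) with hw
  set e : ℝ := Λ * L₀ * (2 / Q₀ + η₀) + 4 * C * η₀ with he
  have hs : 2 * η ≤ ‖z.2‖ := by
    have := hR.le_norm_snd (by linarith) hx hy
    linarith
  have hdrift := abs_sum_drift_le (σ := σ) hρ (lipschitzWith_slice (hφ.comp hL') z.2) (C := C)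
    (fun x => hC _) z.1 N
  -- As `h` commutes with the rotation by `ρ`, the inner orbits become horizontal orbits through the
  -- points `w i`, now seen through `H₀` and `h₀` only.
  have hcomm : ∀ i r : ℕ, (φ ∘ ((H₀.mul h₀).mul h).toPerm) (z.1 + i • σ + r • ρ, z.2) =
      φ ((H₀.mul h₀).toPerm ((w i).1 + r • ρ, (w i).2)) := fun i r => by
    have := hR.toPerm_add_nsmul p r (z.1 + i • σ, z.2)
    simp only at this
    rw [hw, ← this]
    rfl
  simp only [hcomm, NNReal.coe_mul] at hdrift
  -- Outside these indices the circle at height `(w i).2` is equidistributed by `h₀`. Up to `η`, the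
  -- height is `u - i / (K Q)` as long as this stays away from `0`, so the bad indices are visits of
  -- a slow rotation.
  set bad := (Finset.range N).filter fun i => ‖(w i).2‖ < 2 * η₀ with hbad
  set u := F z.2 - Q • z.1 with hu
  have hui : ∀ i : ℕ, F z.2 - Q • (z.1 + i • σ) =
      u - i • ((1 / (K * Q : ℕ) : ℝ) : UnitAddCircle) := fun i => by
    rw [smul_add, smul_comm Q i, hQσ, sub_add_eq_sub_sub]
  have hcard : (bad.card : ℝ) ≤ N / (R + 1) := by
    have hM : 0 < K * Q := by positivity
    have hM' : (0 : ℝ) < (K * Q : ℕ) := by exact_mod_cast hM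
    have hsub : bad ⊆ (Finset.range N).filter
        fun i : ℕ => ‖u - i • ((1 / (K * Q : ℕ) : ℝ) : UnitAddCircle)‖ ≤ 4 * η₀ := by
      intro i hi
      rw [Finset.mem_filter] at hi ⊢
      refine ⟨hi.1, ?_⟩
      by_contra! hlt
      rw [← hui] at hlt
      have h1 := hR.norm_snd_sub_le (z := (z.1 + i • σ, z.2)) (by simp only; linarith) hs
      have h2 := norm_le_norm_sub_add (F z.2 - Q • (z.1 + i • σ)) (w i).2
      rw [norm_sub_rev _ (w i).2] at h2
      have h3 := hi.2
      change ‖(w i).2 - (F z.2 - Q • (z.1 + i • σ))‖ ≤ η at h1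
      linarith
    -- The step `c / (K Q)` must exceed twice the visit radius `4 η₀`. Rounding up costs `1 / (K Q)
    -- ≤ η₀`, and `9 η₀ R + 4 η₀` still fits below `κ₀ / 2 - η`.
    obtain ⟨c, hc1, hc2⟩ : ∃ c : ℕ, 8 * η₀ < c / (K * Q : ℕ) ∧ (c / (K * Q : ℕ) : ℝ) ≤ 9 * η₀ := by
      refine ⟨⌊8 * η₀ * (K * Q : ℕ)⌋₊ + 1, ?_, ?_⟩
      · rw [lt_div_iff₀ hM']
        push_cast
        exact_mod_cast Nat.lt_floor_add_one (8 * η₀ * (K * Q : ℕ))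
      · rw [div_le_iff₀ hM']
        have := Nat.floor_le (show 0 ≤ 8 * η₀ * (K * Q : ℕ) by positivity)
        push_cast at this hKQ ⊢
        linarith
    have hu0 : κ₀ / 2 - η ≤ ‖u‖ := by
      have h1 := hR.norm_sub_snd_le (z := z) (by linarith)
      have h2 := norm_le_norm_sub_add (h.toPerm z).2 u
      rw [norm_sub_rev] at h2
      linarith
    have hR0 : (0 : ℝ) ≤ R := by positivity
    have := card_visits_mul_le (N := N) (R := R) (c := c) hM (u := u) (j := 4 * η₀)
      (d := κ₀ / 2 - η) (by linarith) (by nlinarith) hu0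
    rw [le_div_iff₀ (by positivity)]
    exact_mod_cast (Nat.mul_le_mul_right (R + 1) (Finset.card_le_card hsub)).trans this
  have hterm : ∀ i ∈ Finset.range N,
      |∑ r ∈ Finset.range Q, φ ((H₀.mul h₀).toPerm ((w i).1 + r • ρ, (w i).2)) - Q * ∫ z, φ z| ≤
        (Λ * L + Q * e) + if ‖(w i).2‖ < 2 * η₀ then 2 * Q * C else 0 := by
    intro i _
    split_ifs with hi
    · have h1 : |∑ r ∈ Finset.range Q, φ ((H₀.mul h₀).toPerm ((w i).1 + r • ρ, (w i).2))| ≤ Q * C :=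
        (Finset.abs_sum_le_sum_abs _ _).trans
          ((Finset.sum_le_card_nsmul _ _ C fun r _ => hC _).trans (by simp))
      have h2 : |Q * ∫ z, φ z| ≤ Q * C := by
        rw [abs_mul, abs_of_pos hQ']
        gcongr
        rw [← Real.norm_eq_abs]
        exact (norm_integral_le_of_norm_le_const (C := C) (Eventually.of_forall hC)).trans (by simp)
      have h3 : 0 ≤ Λ * L + Q * e := by positivity
      have := abs_sub (∑ r ∈ Finset.range Q, φ ((H₀.mul h₀).toPerm ((w i).1 + r • ρ, (w i).2)))
        (Q * ∫ z, φ z)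
      linarith
    · rw [add_zero]
      exact hR₀.abs_sum_horizontal_sub_le hQ₀ hQ hp hη₀.le hL₀ hL hφ hC (not_lt.1 hi)
  have hsum : |∑ i ∈ Finset.range N, ∑ r ∈ Finset.range Q,
      φ ((H₀.mul h₀).toPerm ((w i).1 + r • ρ, (w i).2)) - N * (Q * ∫ z, φ z)| ≤
      N * (Λ * L + Q * e) + 2 * Q * C * bad.card := by
    have h1 : ∑ i ∈ Finset.range N, ∑ r ∈ Finset.range Q,
        φ ((H₀.mul h₀).toPerm ((w i).1 + r • ρ, (w i).2)) - N * (Q * ∫ z, φ z) =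
        ∑ i ∈ Finset.range N, (∑ r ∈ Finset.range Q,
        φ ((H₀.mul h₀).toPerm ((w i).1 + r • ρ, (w i).2)) - Q * ∫ z, φ z) := by
      rw [Finset.sum_sub_distrib, Finset.sum_const, Finset.card_range, nsmul_eq_mul]
    rw [h1]
    refine (Finset.abs_sum_le_sum_abs _ _).trans ((Finset.sum_le_sum hterm).trans (le_of_eq ?_))
    rw [Finset.sum_add_distrib, Finset.sum_const, Finset.card_range, nsmul_eq_mul,
      ← Finset.sum_filter, Finset.sum_const, nsmul_eq_mul]
    ring
  set S := ∑ i ∈ Finset.range N, φ (((H₀.mul h₀).mul h).toPerm (z.1 + i • (ρ + σ), z.2))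
  have hσ' : (N : ℝ) * (Λ * L' * (Q * ‖σ‖)) ≤ N * (Λ * L' / (K * Q)) := by
    rw [div_eq_mul_inv]
    gcongr
    calc Q * ‖σ‖ ≤ Q * (1 / (K * Q ^ 2)) := by gcongr
      _ = _ := by field_simp
  have htotal : |Q * S - N * (Q * ∫ z, φ z)| ≤
      Q * (N * (Λ * L' / (K * Q)) + 2 * Q * C) + (N * (Λ * L + Q * e) + 2 * Q * C * (N / (R + 1))) := by
    refine (abs_sub_le _ _ _).trans (add_le_add (hdrift.trans ?_) (hsum.trans ?_))
    · gcongr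
    · gcongr
  have hQS : Q * S - N * (Q * ∫ z, φ z) = Q * (S - N * ∫ z, φ z) := by ring
  rw [hQS, abs_mul, abs_of_pos hQ'] at htotal
  rw [← mul_le_mul_iff_of_pos_left hQ']
  refine htotal.trans (le_of_eq ?_)
  field_simp
  ring

/-! ### The inductive choice of parameters. -/

/-- The state of the inductive construction: a rotation number `p / q`, the composition `H` of the
conjugating maps chosen so far, a Lipschitz constant `L` of it, and a bound `e` for later
parameters. -/
structure ConjState where
  /-- the numerator -/
  p : ℤ
  /-- the denominator -/
  q : ℕ
  /-- the composition of the conjugating maps -/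
  H : TorusDiffeo
  /-- a Lipschitz constant -/
  L : ℕ
  /-- a bound for later parameters -/
  e : ℝ
  q_pos : 0 < q
  coprime : IsCoprime p (q : ℤ)
  e_pos : 0 < e
  L_pos : 0 < L
  lipschitz : LipschitzWith L H.toPerm

/-- The choices made in one step of the construction. -/
structure ConjStep (n : ℕ) (s : ConjState) where
  /-- the next conjugating map -/
  h : TorusDiffeo
  /-- its generating circle map -/
  F : UnitAddCircle → UnitAddCircle
  /-- the inverse width of the exceptional strips -/
  J : ℕ
  /-- the concentration parameter -/
  η : ℝ
  /-- the factor between the denominators -/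
  K : ℕ
  /-- a Lipschitz constant of the next composition -/
  L' : ℕ
  quasi : IsQuasiRotation s.q η h F
  η_pos : 0 < η
  J_pos : 0 < J
  -- The strip width `1 / J` exceeds the dangerous scale `η` by a factor of order `2 ^ n`, so a
  -- point outside the strips gives bad visits a frequency of at most about `2 ^ (-n)` at the next
  -- stage.
  η_le_J : 32 * (((2 ^ n : ℕ) : ℝ) + 1) * η ≤ 1 / J
  η_le_e : η ≤ s.e
  η_le_L : s.L * η ≤ (1 / 2 : ℝ) ^ n
  two_pow_le_J : 2 ^ n ≤ J
  -- The outer exponent `n` makes `J ^ e` beat `2 ^ n (q + 1) (2 L) ^ 2` for each fixed `e > 0` as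
  -- soon as `n e ≥ 1`.
  pow_le_J : (2 ^ n * (s.q + 1) * (2 * s.L) ^ 2) ^ n ≤ J
  K_pos : 0 < K
  one_le_K : 1 ≤ s.e * (K * s.q : ℕ)
  -- For `2 ^ n q` steps the change of angle `1 / (K q ^ 2)` moves orbits by at most `2 ^ (-n)`,
  -- even after the expansion `L'`.
  time_le : L' * (2 ^ n * s.q) * 2 ^ n ≤ K * s.q ^ 2
  L'_pos : 0 < L'
  lipschitz : LipschitzWith L' (s.H.mul h).toPerm
  close : ∀ k ≤ n, ∀ v, ‖iteratedFDeriv ℝ k (fun v =>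
    (s.H.mul h).conjLift ((s.p : ℝ) / s.q + 1 / (K * s.q ^ 2)) v -
      (s.H.mul h).conjLift ((s.p : ℝ) / s.q) v) v‖ ≤ (1 / 2 : ℝ) ^ n
  close_symm : ∀ k ≤ n, ∀ v, ‖iteratedFDeriv ℝ k (fun v =>
    (s.H.mul h).conjLift (-((s.p : ℝ) / s.q + 1 / (K * s.q ^ 2))) v -
      (s.H.mul h).conjLift (-((s.p : ℝ) / s.q)) v) v‖ ≤ (1 / 2 : ℝ) ^ n

/-- The order of choice avoids circularity: `J` depends on the old `q` and `L`, `η` on `J`, `h` on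
`η`, `L'` on `h`, and `K` comes last, constrained only to be large. -/
lemma nonempty_conjStep (n : ℕ) (s : ConjState) : Nonempty (ConjStep n s) := by
  have hq : (0 : ℝ) < s.q := by exact_mod_cast s.q_pos
  have hL : (0 : ℝ) < s.L := by exact_mod_cast s.L_pos
  set J : ℕ := max (2 ^ n) ((2 ^ n * (s.q + 1) * (2 * s.L) ^ 2) ^ n) with hJ
  have hJ0 : 0 < J := lt_of_lt_of_le (by positivity) (le_max_left _ _)
  have hJ1 : (1 : ℝ) ≤ J := by exact_mod_cast hJ0
  have hc : 0 < 32 * (((2 ^ n : ℕ) : ℝ) + 1) := by positivity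
  set η : ℝ := min (1 / J / (32 * (((2 ^ n : ℕ) : ℝ) + 1))) (min s.e ((1 / 2 : ℝ) ^ n / s.L))
    with hη
  have hη0 : 0 < η := lt_min (by positivity) (lt_min s.e_pos (by positivity))
  have hη1 : 32 * (((2 ^ n : ℕ) : ℝ) + 1) * η ≤ 1 / J := by
    rw [mul_comm, ← le_div_iff₀ hc]
    exact min_le_left _ _
  have hη2 : η < 1 / 2 := by
    have h1 : (1 : ℝ) / J ≤ 1 := by rw [div_le_one (by linarith)]; exact hJ1
    have h2 : (0 : ℝ) ≤ ((2 ^ n : ℕ) : ℝ) * η := by positivity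
    nlinarith
  have hη3 : s.L * η ≤ (1 / 2 : ℝ) ^ n := by
    rw [mul_comm, ← le_div_iff₀ hL]
    exact (min_le_right _ _).trans (min_le_right _ _)
  obtain ⟨h, F, hR⟩ := exists_isQuasiRotation s.q s.q_pos hη0 hη2
  obtain ⟨L₁, hL₁⟩ := (s.H.mul h).exists_lipschitzWith
  have hL' : LipschitzWith ((L₁ + 1 : ℕ) : NNReal) (s.H.mul h).toPerm :=
    hL₁.weaken (by exact_mod_cast Nat.le_succ _)
  have hlim : Tendsto (fun K : ℕ => (s.p : ℝ) / s.q + 1 / (K * s.q ^ 2)) atTop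
      (𝓝 ((s.p : ℝ) / s.q)) := by
    have h1 : Tendsto (fun K : ℕ => (K : ℝ) * s.q ^ 2) atTop atTop :=
      tendsto_natCast_atTop_atTop.atTop_mul_const (by positivity)
    simpa using tendsto_const_nhds.add (h1.inv_tendsto_atTop)
  have hpow : (0 : ℝ) < (1 / 2 : ℝ) ^ n := by positivity
  have hcl : ∀ᶠ K : ℕ in atTop, ∀ k ∈ Finset.range (n + 1), ∀ v, ‖iteratedFDeriv ℝ k (fun v =>
      (s.H.mul h).conjLift ((s.p : ℝ) / s.q + 1 / (K * s.q ^ 2)) v -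
      (s.H.mul h).conjLift ((s.p : ℝ) / s.q) v) v‖ < (1 / 2 : ℝ) ^ n := by
    rw [eventually_all_finset]
    exact fun k _ => hlim.eventually ((s.H.mul h).eventually_conjLift_close k _ hpow)
  have hcl' : ∀ᶠ K : ℕ in atTop, ∀ k ∈ Finset.range (n + 1), ∀ v, ‖iteratedFDeriv ℝ k (fun v =>
      (s.H.mul h).conjLift (-((s.p : ℝ) / s.q + 1 / (K * s.q ^ 2))) v -
      (s.H.mul h).conjLift (-((s.p : ℝ) / s.q)) v) v‖ < (1 / 2 : ℝ) ^ n := by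
    rw [eventually_all_finset]
    exact fun k _ => hlim.neg.eventually ((s.H.mul h).eventually_conjLift_close k _ hpow)
  have hK1 : ∀ᶠ K : ℕ in atTop, 1 ≤ s.e * (K * s.q : ℕ) := by
    have h1 : Tendsto (fun K : ℕ => s.e * ((K : ℝ) * s.q)) atTop atTop :=
      (tendsto_natCast_atTop_atTop.atTop_mul_const hq).const_mul_atTop s.e_pos
    filter_upwards [h1.eventually_ge_atTop 1] with K hK
    exact_mod_cast hK
  obtain ⟨K, hK, hK', hK1, hK2, hK3⟩ := (hcl.and (hcl'.and (hK1.and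
    ((eventually_ge_atTop ((L₁ + 1) * (2 ^ n * s.q) * 2 ^ n)).and (eventually_gt_atTop 0))))).exists
  exact ⟨
    { h := h, F := F, J := J, η := η, K := K, L' := L₁ + 1, quasi := hR, η_pos := hη0
      J_pos := hJ0, η_le_J := hη1, η_le_e := (min_le_right _ _).trans (min_le_left _ _)
      η_le_L := hη3, two_pow_le_J := le_max_left _ _, pow_le_J := le_max_right _ _
      K_pos := hK3, one_le_K := hK1
      time_le := hK2.trans (Nat.le_mul_of_pos_right _ (pow_pos s.q_pos 2))
      L'_pos := Nat.succ_pos _, lipschitz := hL'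
      close := fun k hk v => (hK k (Finset.mem_range_succ_iff.2 hk) v).le
      close_symm := fun k hk v => (hK' k (Finset.mem_range_succ_iff.2 hk) v).le }⟩

/-- The state after a step. -/
def ConjStep.next {n : ℕ} {s : ConjState} (d : ConjStep n s) : ConjState where
  p := d.K * s.q * s.p + 1
  q := d.K * s.q ^ 2
  H := s.H.mul d.h
  L := d.L'
  e := d.η
  q_pos := Nat.mul_pos d.K_pos (pow_pos s.q_pos 2)
  coprime := ⟨1 - d.K * s.q * s.p, d.K * s.p ^ 2, by push_cast; ring⟩
  e_pos := d.η_pos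
  L_pos := d.L'_pos
  lipschitz := d.lipschitz

/-- The choice of a step in every state. -/
noncomputable def conjStep (n : ℕ) (s : ConjState) : ConjStep n s := (nonempty_conjStep n s).some

/-- The sequence of states of the construction. -/
noncomputable def conjState : ℕ → ConjState
  | 0 =>
    { p := 0, q := 1, H := TorusDiffeo.one, L := 1, e := 1, q_pos := one_pos
      coprime := by rw [Nat.cast_one]; exact isCoprime_one_right
      e_pos := one_pos, L_pos := one_pos
      lipschitz := by rw [Nat.cast_one]; exact LipschitzWith.id }
  | n + 1 => (conjStep n (conjState n)).next

/-- The step chosen at time `n`. -/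
noncomputable def conjStepAt (n : ℕ) : ConjStep n (conjState n) := conjStep n (conjState n)

lemma conjState_succ (n : ℕ) : conjState (n + 1) = (conjStepAt n).next := rfl

lemma circleAction_mul_comm {Q : ℕ} {η : ℝ} {h : TorusDiffeo} {F : UnitAddCircle → UnitAddCircle}
    (hR : IsQuasiRotation Q η h F) (p : ℤ) :
    circleAction (((p : ℝ) / (Q : ℝ) : ℝ) : UnitAddCircle) * h.toPerm =
      h.toPerm * circleAction (((p : ℝ) / (Q : ℝ) : ℝ) : UnitAddCircle) := by
  ext1 z
  exact (hR.toPerm_add p z).symm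

/-- The approximation-by-conjugation scheme of the construction. -/
noncomputable def conjScheme : AbCScheme where
  p n := (conjState n).p
  q n := (conjState n).q
  k n := (conjStepAt n).K
  l _ := 1
  h n := (conjStepAt n).h.toPerm
  q_zero_pos := (conjState 0).q_pos
  k_pos n := (conjStepAt n).K_pos
  l_pos _ := one_pos
  p_succ n := by rw [conjState_succ]; simp [ConjStep.next]
  q_succ n := by rw [conjState_succ]; simp [ConjStep.next]
  smooth n := (conjStepAt n).h.isSmoothDiffeo
  area_preserving n := (conjStepAt n).h.measurePreserving
  commute n := circleAction_mul_comm (conjStepAt n).quasi _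

lemma conjScheme_H (n : ℕ) : conjScheme.H n = (conjState n).H.toPerm := by
  induction n with
  | zero => rfl
  | succ n ih => rw [AbCScheme.H, ih]; rfl

/-! ### Convergence of the periodic approximations to a diffeomorphism. -/

/-- The real rotation number at time `n`. -/
noncomputable def conjRot (n : ℕ) : ℝ := (conjState n).p / (conjState n).q

lemma conjRot_succ (n : ℕ) : conjRot (n + 1) =
    conjRot n + 1 / ((conjStepAt n).K * (conjState n).q ^ 2) := by
  have hq : ((conjState n).q : ℝ) ≠ 0 := by exact_mod_cast (conjState n).q_pos.ne'
  have hK : ((conjStepAt n).K : ℝ) ≠ 0 := by exact_mod_cast (conjStepAt n).K_pos.ne'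
  simp only [conjRot, conjState_succ, ConjStep.next]
  push_cast
  field_simp

lemma conjScheme_T (n : ℕ) : conjScheme.T n = (conjState (n + 1)).H.toPerm *
    circleAction (conjRot (n + 1) : UnitAddCircle) * (conjState (n + 1)).H.toPerm⁻¹ := by
  rw [AbCScheme.T, conjScheme_H]
  rfl

lemma TorusDiffeo.conjLift_mul {H h : TorusDiffeo} {t : ℝ}
    (hc : ∀ v, h.lift (v + (t, 0)) = h.lift v + (t, 0)) (v : ℝ × ℝ) :
    (H.mul h).conjLift t v = H.conjLift t v := by
  change H.lift (h.lift (h.lift.symm (H.lift.symm v) + (t, 0))) = _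
  rw [hc, Equiv.apply_symm_apply]
  rfl

/-- The lift of the `n`-th periodic approximation to the power `± 1`. -/
noncomputable def approxLift (ε : ℤ) (n : ℕ) : ℝ × ℝ → ℝ × ℝ :=
  (conjState n).H.conjLift (ε * conjRot n)

/-- Since the new `h` commutes with the old rotation, the old approximation can be written with the
new conjugacy. Consecutive approximations thus differ only in their angle. -/
lemma approxLift_eq (ε : ℤ) (n : ℕ) (v : ℝ × ℝ) :
    approxLift ε n v = (conjState (n + 1)).H.conjLift (ε * conjRot n) v := by
  refine (TorusDiffeo.conjLift_mul (fun v => ?_) v).symm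
  have := (conjStepAt n).quasi.lift_comm v (ε * (conjState n).p)
  rwa [Int.cast_mul, mul_div_assoc] at this

lemma norm_iteratedFDeriv_approxLift_sub_le {ε : ℤ} (hε : ε = 1 ∨ ε = -1) (n : ℕ) {k : ℕ}
    (hk : k ≤ n) (v : ℝ × ℝ) :
    ‖iteratedFDeriv ℝ k (fun v => approxLift ε (n + 1) v - approxLift ε n v) v‖ ≤
      (1 / 2 : ℝ) ^ n := by
  simp only [approxLift_eq ε n]
  rw [approxLift, conjRot_succ]
  rcases hε with rfl | rfl
  · simp only [Int.cast_one, one_mul]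
    exact (conjStepAt n).close k hk v
  · simp only [Int.cast_neg, Int.cast_one, neg_mul, one_mul]
    exact (conjStepAt n).close_symm k hk v

lemma approxLift_add (ε : ℤ) (N : ℕ) (v : ℝ × ℝ) (m n : ℤ) :
    approxLift ε N (v + ((m : ℝ), (n : ℝ))) = approxLift ε N v + ((m : ℝ), (n : ℝ)) :=
  TorusDiffeo.conjLift_add _ _ _ _ _

lemma approxLift_neg_apply (ε : ℤ) (n : ℕ) (v : ℝ × ℝ) :
    approxLift (-ε) n (approxLift ε n v) = v := by
  rw [approxLift, approxLift, TorusDiffeo.conjLift_conjLift, Int.cast_neg, neg_mul,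
    add_neg_cancel, TorusDiffeo.conjLift_zero]

lemma tendstoUniformly_of_iteratedFDeriv_zero {E F : Type*} [NormedAddCommGroup E]
    [NormedSpace ℝ E] [NormedAddCommGroup F] [NormedSpace ℝ F] {f : ℕ → E → F} {g : E → F}
    (h : TendstoUniformly (fun n => iteratedFDeriv ℝ 0 (f n)) (iteratedFDeriv ℝ 0 g) atTop) :
    TendstoUniformly f g atTop := by
  rw [Metric.tendstoUniformly_iff] at h ⊢
  simpa only [iteratedFDeriv_zero_eq_comp, Function.comp, LinearIsometryEquiv.dist_map] using h

lemma TendstoUniformly.add_one {α β : Type*} [PseudoMetricSpace β] {f : ℕ → α → β} {g : α → β}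
    (h : TendstoUniformly f g atTop) : TendstoUniformly (fun n => f (n + 1)) g atTop := by
  rw [Metric.tendstoUniformly_iff] at h ⊢
  exact fun ε hε => (tendsto_add_atTop_nat 1).eventually (h ε hε)

lemma exists_lift_limit {ε : ℤ} (hε : ε = 1 ∨ ε = -1) : ∃ G : ℝ × ℝ → ℝ × ℝ, ContDiff ℝ ∞ G ∧
    (∀ v (m n : ℤ), G (v + ((m : ℝ), (n : ℝ))) = G v + ((m : ℝ), (n : ℝ))) ∧
    TendstoUniformly (approxLift ε) G atTop ∧
    ∀ k : ℕ, TendstoUniformly (fun n => iteratedFDeriv ℝ k (approxLift ε (n + 1)))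
      (iteratedFDeriv ℝ k G) atTop := by
  obtain ⟨G, hG, hlim⟩ := exists_smooth_limit (Gs := approxLift ε)
    (fun n => TorusDiffeo.contDiff_conjLift _ _) (approxLift_add ε)
    (fun n k hk v => norm_iteratedFDeriv_approxLift_sub_le hε n hk v)
  have hu := tendstoUniformly_of_iteratedFDeriv_zero (hlim 0)
  refine ⟨G, hG, fun v m n => ?_, hu, fun k => (hlim k).add_one⟩
  refine tendsto_nhds_unique (hu.tendsto_at _) ?_
  simp only [approxLift_add]
  exact (hu.tendsto_at v).add_const _

lemma mk_approxLift_one (n : ℕ) (v : ℝ × ℝ) :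
    torusMk (approxLift 1 (n + 1) v) = conjScheme.T n (torusMk v) := by
  rw [approxLift, TorusDiffeo.mk_conjLift, conjScheme_T, Int.cast_one, one_mul]

lemma mk_approxLift_neg_one (n : ℕ) (v : ℝ × ℝ) :
    torusMk (approxLift (-1) (n + 1) v) = (conjScheme.T n).symm (torusMk v) := by
  rw [Equiv.eq_symm_apply, ← mk_approxLift_one]
  have := approxLift_neg_apply (-1) (n + 1) v
  rw [neg_neg] at this
  rw [this]

lemma exists_conjLimit : ∃ T : Equiv.Perm Torus, IsSmoothDiffeo T ∧
    TendstoSmooth (fun n => conjScheme.T n) T ∧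
    TendstoSmooth (fun n => (conjScheme.T n).symm) T.symm ∧
    TendstoUniformly (fun n => conjScheme.T n) T atTop := by
  obtain ⟨G, hG, hGp, hGu, hGk⟩ := exists_lift_limit (Or.inl rfl)
  obtain ⟨G', hG', hGp', hGu', hGk'⟩ := exists_lift_limit (Or.inr rfl)
  -- Invertibility of the limit comes from taking limits of the inverses separately and passing to
  -- the limit in the composition.
  have hinv : ∀ v, G' (G v) = v := fun v => by
    refine tendsto_nhds_unique (hGu'.tendsto_comp hG'.continuous.continuousAt
      (hGu.tendsto_at v)) ?_
    simp only [approxLift_neg_apply]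
    exact tendsto_const_nhds
  have hinv' : ∀ v, G (G' v) = v := fun v => by
    refine tendsto_nhds_unique (hGu.tendsto_comp hG.continuous.continuousAt
      (hGu'.tendsto_at v)) ?_
    have : ∀ n, approxLift 1 n (approxLift (-1) n v) = v := fun n => by
      simpa using approxLift_neg_apply (-1) n v
    simp only [this]
    exact tendsto_const_nhds
  have hdesc : ∀ {G : ℝ × ℝ → ℝ × ℝ},
      (∀ v (m n : ℤ), G (v + ((m : ℝ), (n : ℝ))) = G v + ((m : ℝ), (n : ℝ))) → ∀ v,
      torusMk (G (Function.surjInv torusMk_surjective (torusMk v))) = torusMk (G v) := by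
    intro G hp v
    obtain ⟨m, n, hmn⟩ := exists_int_of_torusMk_eq
      (Function.surjInv_eq torusMk_surjective (torusMk v))
    rw [hmn, hp, torusMk_add_int]
  let T : Equiv.Perm Torus :=
    { toFun := fun x => torusMk (G (Function.surjInv torusMk_surjective x))
      invFun := fun x => torusMk (G' (Function.surjInv torusMk_surjective x))
      left_inv := fun x => by
        simp only
        rw [hdesc hGp', hinv, Function.surjInv_eq torusMk_surjective]
      right_inv := fun x => by
        simp only
        rw [hdesc hGp, hinv', Function.surjInv_eq torusMk_surjective] }
  have hT : IsSmoothLift G T := ⟨hG, fun v => (hdesc hGp v).symm⟩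
  have hT' : IsSmoothLift G' T.symm := ⟨hG', fun v => (hdesc hGp' v).symm⟩
  refine ⟨T, ⟨⟨G, hT⟩, ⟨G', hT'⟩⟩, ⟨fun n => approxLift 1 (n + 1), G, fun n =>
    ⟨TorusDiffeo.contDiff_conjLift _ _, mk_approxLift_one n⟩, hT, hGk⟩,
    ⟨fun n => approxLift (-1) (n + 1), G', fun n =>
    ⟨TorusDiffeo.contDiff_conjLift _ _, mk_approxLift_neg_one n⟩, hT', hGk'⟩, ?_⟩
  have h1 := hGu.add_one
  rw [Metric.tendstoUniformly_iff] at h1 ⊢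
  intro δ hδ
  filter_upwards [h1 δ hδ] with n hn x
  obtain ⟨v, rfl⟩ := torusMk_surjective x
  rw [← mk_approxLift_one, ← hT.2]
  exact (TorusDiffeo.dist_torusMk_le _ _).trans_lt (hn v)

lemma iterate_conj_circleAction (h : Equiv.Perm Torus) (t : UnitAddCircle) (i : ℕ) (x : Torus) :
    (h * circleAction t * h⁻¹)^[i] x = h ((h⁻¹ x).1 + i • t, (h⁻¹ x).2) := by
  induction i with
  | zero => simp
  | succ i ih =>
    rw [Function.iterate_succ_apply', ih]
    simp [circleAction, add_smul, add_assoc]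

/-! ### Orbit comparison, bad sets and Birkhoff averages of the limit. -/

/-- The periodic approximation with rotation number `conjRot n`. -/
noncomputable def approxMap (n : ℕ) : Equiv.Perm Torus :=
  (conjState n).H.toPerm * circleAction (conjRot n : UnitAddCircle) * (conjState n).H.toPerm⁻¹

lemma conjScheme_T_eq (n : ℕ) : conjScheme.T n = approxMap (n + 1) := conjScheme_T n

lemma conjState_succ_H (n : ℕ) :
    (conjState (n + 1)).H.toPerm = (conjState n).H.toPerm * (conjStepAt n).h.toPerm := rfl

lemma approxMap_eq (n : ℕ) : approxMap n = (conjState (n + 1)).H.toPerm *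
    circleAction (conjRot n : UnitAddCircle) * (conjState (n + 1)).H.toPerm⁻¹ := by
  have h : circleAction (conjRot n : UnitAddCircle) * (conjStepAt n).h.toPerm =
      (conjStepAt n).h.toPerm * circleAction (conjRot n : UnitAddCircle) :=
    circleAction_mul_comm (conjStepAt n).quasi _
  have h' : circleAction (conjRot n : UnitAddCircle) = (conjStepAt n).h.toPerm *
      circleAction (conjRot n : UnitAddCircle) * (conjStepAt n).h.toPerm⁻¹ := by
    rw [← h, mul_inv_cancel_right]
  rw [approxMap, conjState_succ_H, mul_inv_rev]
  conv_lhs => rw [h']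
  simp only [mul_assoc]

lemma conjState_q_cast (n : ℕ) :
    ((conjState (n + 1)).q : ℝ) = (conjStepAt n).K * (conjState n).q ^ 2 := by
  simp [conjState_succ, ConjStep.next]

lemma conjState_q_pos (n : ℕ) : (0 : ℝ) < (conjState n).q := by
  exact_mod_cast (conjState n).q_pos

lemma one_le_conjState_q (n : ℕ) : (1 : ℝ) ≤ (conjState n).q := by
  exact_mod_cast (conjState n).q_pos

lemma conjState_time_le (n : ℕ) : ((conjState (n + 1)).L : ℝ) * (2 ^ n * (conjState n).q) * 2 ^ n ≤
    (conjState (n + 1)).q := by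
  rw [conjState_q_cast]
  exact_mod_cast (conjStepAt n).time_le

lemma conjState_L_div_q_succ_le (n : ℕ) :
    ((conjState (n + 1)).L : ℝ) / (conjState (n + 1)).q ≤ (1 / 2 : ℝ) ^ n := by
  have h1 := conjState_time_le n
  have h2 := one_le_conjState_q n
  rw [div_le_iff₀ (conjState_q_pos _), one_div, inv_pow, inv_mul_eq_div, le_div_iff₀ (by positivity)]
  refine le_trans ?_ h1
  gcongr
  have : (1 : ℝ) ≤ 2 ^ n := one_le_pow₀ (by norm_num)
  exact le_mul_of_one_le_right (by positivity) (by nlinarith)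

lemma conjState_L_div_q_le (n : ℕ) :
    ((conjState n).L : ℝ) / (conjState n).q ≤ 2 * (1 / 2 : ℝ) ^ n := by
  cases n with
  | zero => norm_num [conjState]
  | succ n =>
    refine (conjState_L_div_q_succ_le n).trans (le_of_eq ?_)
    ring

/-- The time scale up to which the `n`-th approximation is valid. -/
noncomputable def timeScale (n : ℕ) : ℕ := 2 ^ n * (conjState n).q

lemma timeScale_mono : Monotone timeScale := by
  refine monotone_nat_of_le_succ fun n => ?_
  refine Nat.mul_le_mul (Nat.pow_le_pow_right two_pos n.le_succ) ?_
  have hK := (conjStepAt n).K_pos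
  have hq := (conjState n).q_pos
  simp only [conjState_succ, ConjStep.next]
  nlinarith [Nat.mul_le_mul hK hq]

lemma two_pow_le_timeScale (n : ℕ) : 2 ^ n ≤ timeScale n :=
  Nat.le_mul_of_pos_right _ (conjState n).q_pos

/-- Written with the common conjugacy from `approxMap_eq`, the two maps are rotations with angles `1
/ q` apart, `q` the new denominator. The accumulated error `i / q` is multiplied by the Lipschitz
constant and bounded by `conjState_time_le`. -/
lemma dist_approxMap_iterate_le {n i : ℕ} (hi : i ≤ timeScale n) (x : Torus) :
    dist ((approxMap n)^[i] x) ((approxMap (n + 1))^[i] x) ≤ (1 / 2 : ℝ) ^ n := by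
  rw [approxMap_eq, approxMap, iterate_conj_circleAction, iterate_conj_circleAction]
  have hq := conjState_q_pos (n + 1)
  refine ((conjState (n + 1)).lipschitz.dist_le_mul _ _).trans ?_
  set z := (conjState (n + 1)).H.toPerm⁻¹ x
  have h1 : dist (z.1 + i • (conjRot n : UnitAddCircle), z.2)
      (z.1 + i • (conjRot (n + 1) : UnitAddCircle), z.2) ≤ i / (conjState (n + 1)).q := by
    rw [Prod.dist_eq, dist_self, max_eq_left dist_nonneg, dist_add_left, dist_eq_norm, ← smul_sub,
      ← AddCircle.coe_sub, conjRot_succ, ← conjState_q_cast, sub_add_cancel_left,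
      ← AddCircle.coe_nsmul]
    refine (unitAddCircle_norm_coe_le _).trans (le_of_eq ?_)
    rw [nsmul_eq_mul, abs_mul, abs_neg, Nat.abs_cast, abs_of_pos (one_div_pos.2 hq), mul_one_div]
  have h2 : (i : ℝ) ≤ 2 ^ n * (conjState n).q := by exact_mod_cast hi
  have h3 := conjState_time_le n
  rw [NNReal.coe_natCast]
  calc _ ≤ ((conjState (n + 1)).L : ℝ) * (i / (conjState (n + 1)).q) := by gcongr
    _ ≤ ((conjState (n + 1)).L : ℝ) * ((2 ^ n * (conjState n).q) / (conjState (n + 1)).q) := by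
      gcongr
    _ ≤ (1 / 2 : ℝ) ^ n := by
      rw [← mul_div_assoc, div_le_iff₀ hq, one_div, inv_pow, inv_mul_eq_div,
        le_div_iff₀ (by positivity)]
      exact h3

/-- The exceptional set at stage `n`, in the coordinates of that stage. -/
noncomputable def badStrip (n : ℕ) : Set Torus :=
  {w | ‖-((conjState n).q • w.1) - ((1 / 2 : ℝ) : UnitAddCircle)‖ ≤ 1 / (conjStepAt n).J ∨
    ‖w.2‖ ≤ 1 / (conjStepAt n).J}

/-- The exceptional set at stage `n`. -/
noncomputable def badSet (n : ℕ) : Set Torus := (conjState n).H.toPerm '' badStrip n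

lemma notMem_badSet {n : ℕ} {x : Torus} (hx : x ∉ badSet n) :
    1 / (conjStepAt n).J < ‖-((conjState n).q • ((conjState n).H.toPerm⁻¹ x).1) -
        ((1 / 2 : ℝ) : UnitAddCircle)‖ ∧
      1 / (conjStepAt n).J < ‖((conjState n).H.toPerm⁻¹ x).2‖ := by
  have h : (conjState n).H.toPerm⁻¹ x ∉ badStrip n := fun hb => hx ⟨_, hb, by simp⟩
  simpa [badStrip] using h

lemma four_mul_η_le (n : ℕ) : 4 * (conjStepAt n).η ≤ 1 / (conjStepAt n).J := by
  have h1 := (conjStepAt n).η_le_J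
  have h2 : 0 ≤ ((2 ^ n : ℕ) : ℝ) * (conjStepAt n).η :=
    mul_nonneg (by positivity) (conjStepAt n).η_pos.le
  linarith [(conjStepAt n).η_pos]

lemma conjStepAt_h_apply (n : ℕ) (x : Torus) :
    (conjStepAt n).h.toPerm ((conjState (n + 1)).H.toPerm⁻¹ x) = (conjState n).H.toPerm⁻¹ x := by
  rw [conjState_succ_H, mul_inv_rev]
  simp

lemma η_le_two_pow (n : ℕ) : (conjStepAt n).η ≤ (1 / 2 : ℝ) ^ n := by
  refine le_trans ?_ (conjStepAt n).η_le_L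
  exact le_mul_of_one_le_left (conjStepAt n).η_pos.le (by exact_mod_cast (conjState n).L_pos)

/-- Two stages are needed. Avoiding `badSet n` keeps the initial height at stage `n + 1` away from
`0`; avoiding `badSet (n + 1)` makes the drift parameter `u` agree with that height up to `η`. Every
error in `abs_birkhoffSum_approx_le` is then of order `2 ^ (-n)`. -/
lemma abs_sum_approxMap_sub_le {φ : Torus → ℝ} {Λ : NNReal} (hφ : LipschitzWith Λ φ) {C : ℝ}
    (hC : ∀ z, |φ z| ≤ C) {n : ℕ} {x : Torus} (hx₀ : x ∉ badSet n) (hx : x ∉ badSet (n + 1))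
    {N : ℕ} (hN : timeScale (n + 1) ≤ N) :
    |∑ i ∈ Finset.range N, φ ((approxMap (n + 2))^[i] x) - N * ∫ z, φ z| ≤
      N * ((8 * Λ + 8 * C) * (1 / 2 : ℝ) ^ n) := by
  have hC0 : 0 ≤ C := (abs_nonneg _).trans (hC 0)
  have hQ₀ := conjState_q_pos n
  have hQ := conjState_q_pos (n + 1)
  have hK : (0 : ℝ) < (conjStepAt (n + 1)).K := by exact_mod_cast (conjStepAt (n + 1)).K_pos
  have hη := (conjStepAt n).η_pos
  set z := (conjState (n + 2)).H.toPerm⁻¹ x with hz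
  have hw : (conjStepAt (n + 1)).h.toPerm z = (conjState (n + 1)).H.toPerm⁻¹ x :=
    conjStepAt_h_apply (n + 1) x
  have hx' := notMem_badSet hx
  have hx₀' := notMem_badSet hx₀
  rw [← conjStepAt_h_apply n] at hx₀'
  have hκ₀ := (conjStepAt n).quasi.le_norm_snd (by linarith [four_mul_η_le n]) hx₀'.1 hx₀'.2
  rw [← hw] at hκ₀ hx'
  have main := abs_birkhoffSum_approx_le (H₀ := (conjState n).H) (R := 2 ^ n)
    (conjState n).q_pos (conjState (n + 1)).q_pos
    (conjStepAt (n + 1)).K_pos (conjState (n + 1)).coprime (conjStepAt n).η_pos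
    (conjStepAt (n + 1)).η_pos (conjStepAt (n + 1)).η_le_e (four_mul_η_le (n + 1))
    (conjStepAt n).η_le_J (conjStepAt (n + 1)).one_le_K (conjStepAt n).quasi
    (conjStepAt (n + 1)).quasi (conjState n).lipschitz (conjState (n + 1)).lipschitz
    (conjState (n + 2)).lipschitz hφ hC hx'.1 hx'.2 hκ₀ N
  have hiter : ∀ i, (approxMap (n + 2))^[i] x = (conjState (n + 2)).H.toPerm
      (z.1 + i • (((((conjState (n + 1)).p : ℝ) / (conjState (n + 1)).q : ℝ) : UnitAddCircle) +
      ((1 / ((conjStepAt (n + 1)).K * (conjState (n + 1)).q ^ 2) : ℝ) : UnitAddCircle)), z.2) := by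
    intro i
    rw [approxMap, iterate_conj_circleAction, conjRot_succ (n + 1), AddCircle.coe_add]
    rfl
  simp only [hiter]
  refine main.trans ?_
  simp only [NNReal.coe_natCast]
  have hpow : (0 : ℝ) < (1 / 2 : ℝ) ^ n := by positivity
  have e1 : (Λ : ℝ) * (conjState (n + 2)).L / ((conjStepAt (n + 1)).K * (conjState (n + 1)).q) ≤
      Λ * (1 / 2 : ℝ) ^ n := by
    rw [mul_div_assoc]
    gcongr
    have h1 := conjState_time_le (n + 1)
    rw [conjState_q_cast (n + 1)] at h1
    rw [div_le_iff₀ (by positivity), one_div, inv_pow, inv_mul_eq_div, le_div_iff₀ (by positivity)]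
    have h2 : (1 : ℝ) ≤ 2 ^ n := one_le_pow₀ (by norm_num)
    have hL : (0 : ℝ) ≤ (conjState (n + 2)).L := by positivity
    refine le_of_mul_le_mul_right ?_ hQ
    calc _ ≤ ((conjState (n + 2)).L : ℝ) * (2 ^ (n + 1) * (conjState (n + 1)).q) * 2 ^ (n + 1) := by
          rw [pow_succ]
          have : (0 : ℝ) ≤ (conjState (n + 2)).L * 2 ^ n * (conjState (n + 1)).q := by positivity
          nlinarith
      _ ≤ _ := h1
      _ = _ := by ring
  have e2 : 2 * ((conjState (n + 1)).q : ℝ) * C ≤ N * (2 * C * (1 / 2 : ℝ) ^ n) := by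
    have h1 : (2 : ℝ) ^ (n + 1) * (conjState (n + 1)).q ≤ N := by exact_mod_cast hN
    have h2 : ((conjState (n + 1)).q : ℝ) ≤ N * (1 / 2 : ℝ) ^ n := by
      rw [one_div, inv_pow, ← div_eq_mul_inv, le_div_iff₀ (by positivity)]
      refine le_trans ?_ h1
      rw [mul_comm]
      gcongr <;> norm_num
    nlinarith
  have e3 : (Λ : ℝ) * (conjState (n + 1)).L / (conjState (n + 1)).q ≤ Λ * (1 / 2 : ℝ) ^ n := by
    rw [mul_div_assoc]
    gcongr
    exact conjState_L_div_q_succ_le n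
  have e4 : (Λ : ℝ) * (conjState n).L * (2 / (conjState n).q + (conjStepAt n).η) ≤
      Λ * (5 * (1 / 2 : ℝ) ^ n) := by
    rw [mul_assoc]
    refine mul_le_mul_of_nonneg_left ?_ Λ.coe_nonneg
    have h1 := conjState_L_div_q_le n
    have h2 := (conjStepAt n).η_le_L
    rw [mul_add, mul_div_left_comm]
    linarith
  have e5 : 4 * C * (conjStepAt n).η ≤ 4 * C * (1 / 2 : ℝ) ^ n := by
    gcongr
    exact η_le_two_pow n
  have e6 : 2 * C * (N / (((2 ^ n : ℕ) : ℝ) + 1)) ≤ N * (2 * C * (1 / 2 : ℝ) ^ n) := by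
    have h1 : (N : ℝ) / (((2 ^ n : ℕ) : ℝ) + 1) ≤ N * (1 / 2 : ℝ) ^ n := by
      rw [one_div, inv_pow, ← div_eq_mul_inv]
      push_cast
      gcongr
      linarith
    nlinarith
  have hN0 : (0 : ℝ) ≤ N := by positivity
  have e7 := mul_le_mul_of_nonneg_left (add_le_add e3 (add_le_add e4 e5)) hN0
  have e8 := mul_le_mul_of_nonneg_left e1 hN0
  refine (add_le_add (add_le_add (add_le_add e8 e2) e7) e6).trans ?_
  have e9 : 0 ≤ N * (Λ * (1 / 2 : ℝ) ^ n) := by positivity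
  linarith

section Limit

variable {T : Equiv.Perm Torus}

lemma continuous_toPerm (h : TorusDiffeo) : Continuous h.toPerm := by
  obtain ⟨L, hL⟩ := h.exists_lipschitzWith
  exact hL.continuous

lemma IsSmoothDiffeo.continuous {f : Equiv.Perm Torus} (hf : IsSmoothDiffeo f) : Continuous f := by
  obtain ⟨F, hF, hFf⟩ := hf.1
  have hq : Topology.IsQuotientMap torusMk := by
    refine IsOpenMap.isQuotientMap ?_ continuous_torusMk torusMk_surjective
    exact (QuotientAddGroup.isOpenMap_coe (N := AddSubgroup.zmultiples (1 : ℝ))).prodMap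
      (QuotientAddGroup.isOpenMap_coe (N := AddSubgroup.zmultiples (1 : ℝ)))
  rw [hq.continuous_iff]
  exact (continuous_torusMk.comp hF.continuous).congr hFf

lemma tendsto_approxMap_iterate (hT : TendstoUniformly (fun n => conjScheme.T n) T atTop)
    (hc : Continuous T) (i : ℕ) (x : Torus) :
    Tendsto (fun n => (approxMap n)^[i] x) atTop (𝓝 (T^[i] x)) := by
  rw [← tendsto_add_atTop_iff_nat 1]
  induction i with
  | zero => simp
  | succ i ih =>
    simp only [Function.iterate_succ_apply', ← conjScheme_T_eq] at ih ⊢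
    exact hT.tendsto_comp hc.continuousAt ih

lemma dist_approxMap_limit_iterate_le (hT : TendstoUniformly (fun n => conjScheme.T n) T atTop)
    (hc : Continuous T) {n i : ℕ} (hi : i ≤ timeScale n)
    (x : Torus) : dist ((approxMap n)^[i] x) (T^[i] x) ≤ 2 * (1 / 2 : ℝ) ^ n := by
  have h1 := dist_le_of_le_geometric_of_tendsto₀ (1 / 2 : ℝ) ((1 / 2 : ℝ) ^ n)
    (f := fun m => (approxMap (n + m))^[i] x) (by norm_num) (fun m => by
      rw [← pow_add]
      exact dist_approxMap_iterate_le (hi.trans (timeScale_mono (Nat.le_add_right n m))) x)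
    (a := T^[i] x) (by
      simp only [add_comm n]
      exact (tendsto_add_atTop_iff_nat n).2 (tendsto_approxMap_iterate hT hc i x))
  refine h1.trans (le_of_eq ?_)
  ring

/-- The lower bound on `N` makes boundary terms negligible; the upper bound is the time for which
the approximation shadows `T`. -/
lemma abs_birkhoffAverage_sub_le (hT : TendstoUniformly (fun n => conjScheme.T n) T atTop)
    (hc : Continuous T) {φ : Torus → ℝ} {Λ : NNReal}
    (hφ : LipschitzWith Λ φ) {C : ℝ}
    (hC : ∀ z, |φ z| ≤ C) {n : ℕ} {x : Torus} (hx₀ : x ∉ badSet n) (hx : x ∉ badSet (n + 1))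
    {N : ℕ} (hN : timeScale (n + 1) ≤ N) (hN' : N ≤ timeScale (n + 2)) :
    |birkhoffAverage ℝ T φ N x - ∫ z, φ z| ≤ (9 * Λ + 8 * C) * (1 / 2 : ℝ) ^ n := by
  have hN0 : (0 : ℝ) < N := by
    exact_mod_cast (pow_pos two_pos _).trans_le ((two_pow_le_timeScale (n + 1)).trans hN)
  have h1 := abs_sum_approxMap_sub_le hφ hC hx₀ hx hN
  have h2 : |∑ i ∈ Finset.range N, φ (T^[i] x) -
      ∑ i ∈ Finset.range N, φ ((approxMap (n + 2))^[i] x)| ≤ N * (Λ * (1 / 2 : ℝ) ^ n) := by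
    rw [← Finset.sum_sub_distrib]
    refine (Finset.abs_sum_le_sum_abs _ _).trans
      ((Finset.sum_le_card_nsmul _ _ (Λ * (1 / 2 : ℝ) ^ n) fun i hi => ?_).trans (by simp))
    rw [← Real.dist_eq]
    refine (hφ.dist_le_mul _ _).trans ?_
    gcongr
    rw [dist_comm]
    refine (dist_approxMap_limit_iterate_le hT hc
      ((Finset.mem_range.1 hi).le.trans hN') x).trans ?_
    rw [pow_add]
    have : (0 : ℝ) < (1 / 2 : ℝ) ^ n := by positivity
    linarith
  have h3 : birkhoffAverage ℝ T φ N x - ∫ z, φ z =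
      (∑ i ∈ Finset.range N, φ (T^[i] x) - N * ∫ z, φ z) / N := by
    rw [birkhoffAverage, birkhoffSum, smul_eq_mul]
    field_simp
  rw [h3, abs_div, abs_of_pos hN0, div_le_iff₀ hN0]
  refine (abs_sub_le _ _ _).trans ((add_le_add h2 h1).trans (le_of_eq ?_))
  ring

lemma tendsto_birkhoffAverage_of_lipschitz (hT : TendstoUniformly (fun n => conjScheme.T n) T atTop)
    (hc : Continuous T) {φ : Torus → ℝ} {Λ : NNReal}
    (hφ : LipschitzWith Λ φ) {x : Torus} (hx : ∀ᶠ n in atTop, x ∉ badSet n) :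
    Tendsto (fun N => birkhoffAverage ℝ T φ N x) atTop (𝓝 (∫ z, φ z)) := by
  obtain ⟨C, hC⟩ := isCompact_univ.exists_bound_of_continuousOn hφ.continuous.continuousOn
  have hC' : ∀ z, |φ z| ≤ C := fun z => hC z (Set.mem_univ z)
  rw [Metric.tendsto_atTop]
  intro ε hε
  have hlim : Tendsto (fun n : ℕ => (9 * Λ + 8 * C) * (1 / 2 : ℝ) ^ n) atTop (𝓝 0) := by
    simpa using (tendsto_pow_atTop_nhds_zero_of_lt_one (r := (1 / 2 : ℝ)) (by norm_num)
      (by norm_num)).const_mul (9 * Λ + 8 * C)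
  obtain ⟨n₀, hn₀⟩ := eventually_atTop.1 (hx.and (hlim.eventually (gt_mem_nhds hε)))
  refine ⟨timeScale (n₀ + 1), fun N hN => ?_⟩
  -- The least such `m` is at least `2` and is written `n + 2`, so that `N` lies in the window
  -- controlled by stages `n` and `n + 1`.
  have hex : ∃ m, N < timeScale m := ⟨N, Nat.lt_two_pow_self.trans_le (two_pow_le_timeScale N)⟩
  classical
  have hm := Nat.find_spec hex
  have hlt : n₀ + 1 < Nat.find hex := by
    by_contra! hle
    exact absurd (hm.trans_le (timeScale_mono hle)) (not_lt.2 hN)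
  obtain ⟨n, hn⟩ := Nat.exists_eq_add_of_le' (show 2 ≤ Nat.find hex by omega)
  have hNn : timeScale (n + 1) ≤ N := not_lt.1 (Nat.find_min hex (by omega))
  rw [hn] at hm
  rw [Real.dist_eq]
  exact (abs_birkhoffAverage_sub_le hT hc hφ hC' (hn₀ n (by omega)).1 (hn₀ (n + 1) (by omega)).1
    hNn hm.le).trans_lt (hn₀ n (by omega)).2

end Limit

/-! ### Genericity from Lipschitz tests, ergodicity and invariance of the measure. -/

/-- Lipschitz functions are uniformly dense in the continuous functions on a compact space. -/
lemma exists_lipschitzWith_close {X : Type*} [PseudoMetricSpace X] [CompactSpace X] {φ : X → ℝ}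
    (hφ : Continuous φ) {ε : ℝ} (hε : 0 < ε) :
    ∃ (ψ : X → ℝ) (Λ : NNReal), LipschitzWith Λ ψ ∧ ∀ x, |φ x - ψ x| ≤ ε := by
  obtain ⟨C, hC⟩ := isCompact_univ.exists_bound_of_continuousOn hφ.continuousOn
  have hC' : ∀ x, |φ x| ≤ C := fun x => hC x (Set.mem_univ x)
  obtain ⟨δ, hδ, hδε⟩ := Metric.uniformContinuous_iff.1
    (CompactSpace.uniformContinuous_of_continuous hφ) ε hε
  rcases isEmpty_or_nonempty X with hX | ⟨⟨x₀⟩⟩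
  · exact ⟨φ, 0, fun x => isEmptyElim x, fun x => isEmptyElim x⟩
  have hC0 : 0 ≤ C := (abs_nonneg _).trans (hC' x₀)
  have : Nonempty X := ⟨x₀⟩
  set K : ℝ := 2 * C / δ with hK
  have hK0 : 0 ≤ K := by positivity
  have hbdd : ∀ x, BddBelow (Set.range fun y => φ y + K * dist x y) := fun x =>
    ⟨-C, by
      rintro _ ⟨y, rfl⟩
      have h1 := (abs_le.1 (hC' y)).1
      have h2 : 0 ≤ K * dist x y := by positivity
      simp only
      linarith⟩
  -- Inf-convolution with slope `K = 2 C / δ`: points farther than `δ` cannot lower the infimum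
  -- below `φ x`, and nearer ones lower it by at most `ε`.
  refine ⟨fun x => ⨅ y, (φ y + K * dist x y), K.toNNReal, LipschitzWith.of_le_add_mul _ fun x x' => ?_,
    fun x => ?_⟩
  · rw [← sub_le_iff_le_add]
    refine le_ciInf fun y => ?_
    rw [sub_le_iff_le_add]
    refine (ciInf_le (hbdd x) y).trans ?_
    have h1 : K * dist x y ≤ K * (dist x x' + dist x' y) := by
      gcongr
      exact dist_triangle _ _ _
    rw [Real.coe_toNNReal K hK0]
    linarith
  · have h1 : ⨅ y, (φ y + K * dist x y) ≤ φ x := by simpa using ciInf_le (hbdd x) x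
    have h2 : φ x - ε ≤ ⨅ y, (φ y + K * dist x y) := by
      refine le_ciInf fun y => ?_
      rcases lt_or_ge (dist x y) δ with h | h
      · have h3 := hδε h
        rw [Real.dist_eq, abs_lt] at h3
        have h4 : 0 ≤ K * dist x y := by positivity
        linarith
      · have h3 : 2 * C ≤ K * dist x y := by
          calc 2 * C = K * δ := by rw [hK]; field_simp
            _ ≤ _ := by gcongr
        have h4 := abs_le.1 (hC' x)
        have h5 := abs_le.1 (hC' y)
        linarith
    rw [abs_le]
    constructor <;> linarith

lemma abs_birkhoffAverage_sub_birkhoffAverage_le {X : Type*} {f : X → X} {φ ψ : X → ℝ} {ε : ℝ}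
    (hε : 0 ≤ ε) (h : ∀ x, |φ x - ψ x| ≤ ε) (N : ℕ) (x : X) :
    |birkhoffAverage ℝ f φ N x - birkhoffAverage ℝ f ψ N x| ≤ ε := by
  rw [birkhoffAverage, birkhoffAverage, ← smul_sub, birkhoffSum, birkhoffSum,
    ← Finset.sum_sub_distrib, smul_eq_mul, abs_mul, abs_inv, Nat.abs_cast]
  rcases N.eq_zero_or_pos with rfl | hN
  · simpa using hε
  have hN' : (0 : ℝ) < N := by exact_mod_cast hN
  rw [inv_mul_le_iff₀ hN']
  exact (Finset.abs_sum_le_sum_abs _ _).trans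
    ((Finset.sum_le_card_nsmul _ _ ε fun i _ => h _).trans (by simp))

lemma isBirkhoffGeneric_of_lipschitz {X : Type*} [PseudoMetricSpace X] [CompactSpace X]
    [MeasurableSpace X] [BorelSpace X] {μ : Measure X} [IsProbabilityMeasure μ] {f : X → X} {x : X}
    (h : ∀ (ψ : X → ℝ) (Λ : NNReal), LipschitzWith Λ ψ →
      Tendsto (fun N => birkhoffAverage ℝ f ψ N x) atTop (𝓝 (∫ z, ψ z ∂μ))) :
    IsBirkhoffGeneric f μ x := by
  intro φ hφ _
  rw [Metric.tendsto_atTop]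
  intro ε hε
  obtain ⟨ψ, Λ, hψ, hclose⟩ := exists_lipschitzWith_close hφ (show 0 < ε / 4 by positivity)
  obtain ⟨N₀, hN₀⟩ := Metric.tendsto_atTop.1 (h ψ Λ hψ) (ε / 4) (by positivity)
  refine ⟨N₀, fun N hN => ?_⟩
  have h1 := abs_birkhoffAverage_sub_birkhoffAverage_le (f := f) (by positivity) hclose N x
  have h2 := hN₀ N hN
  have h3 : |∫ z, φ z ∂μ - ∫ z, ψ z ∂μ| ≤ ε / 4 := by
    rw [← integral_sub hφ.integrable_of_compactSpace hψ.continuous.integrable_of_compactSpace,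
      ← Real.norm_eq_abs]
    exact (norm_integral_le_of_norm_le_const (C := ε / 4) (Eventually.of_forall hclose)).trans
      (by simp)
  rw [Real.dist_eq, abs_lt] at h2 ⊢
  rw [abs_le] at h1 h3
  constructor <;> linarith

/-- If almost every point is generic for an invariant measure, the measure is ergodic. -/
lemma ergodic_of_ae_isBirkhoffGeneric {X : Type*} [PseudoMetricSpace X] [CompactSpace X]
    [MeasurableSpace X] [BorelSpace X] {μ : Measure X} [IsProbabilityMeasure μ] {f : X → X}
    (hf : MeasurePreserving f μ μ) (hc : Continuous f) (h : ∀ᵐ x ∂μ, IsBirkhoffGeneric f μ x) :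
    Ergodic f μ := by
  refine ⟨hf, ⟨fun s hs hinv => ?_⟩⟩
  have hfs : MeasurePreserving f (μ.restrict s) (μ.restrict s) := by
    have := hf.restrict_preimage hs
    rwa [hinv] at this
  -- On an invariant set the integral of each Birkhoff average equals that of `φ`, while dominated
  -- convergence sends it to `μ(s) ∫ φ`. Hence `μ` restricted to `s` is `μ(s) μ`, and evaluation on
  -- `sᶜ` gives the zero-one law.
  have key : ∀ φ : X → ℝ, Continuous φ → ∫ x in s, φ x ∂μ = μ.real s * ∫ x, φ x ∂μ := by
    intro φ hφ
    obtain ⟨C, hC⟩ := isCompact_univ.exists_bound_of_continuousOn hφ.continuousOn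
    have hC' : ∀ x, |φ x| ≤ C := fun x => hC x (Set.mem_univ x)
    have hci : ∀ i : ℕ, Continuous fun x => φ (f^[i] x) := fun i => hφ.comp (hc.iterate i)
    have hcont : ∀ N, Continuous fun x => birkhoffAverage ℝ f φ N x := fun N => by
      simp only [birkhoffAverage, birkhoffSum, smul_eq_mul]
      exact continuous_const.mul (continuous_finsetSum _ fun i _ => hci i)
    have hlim : Tendsto (fun N => ∫ x in s, birkhoffAverage ℝ f φ N x ∂μ) atTop
        (𝓝 (∫ _ in s, (∫ y, φ y ∂μ) ∂μ)) := by
      refine tendsto_integral_of_dominated_convergence (fun _ => max C 0)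
        (fun N => (hcont N).aestronglyMeasurable) (integrable_const _)
        (fun N => Eventually.of_forall fun x => ?_) ?_
      · have := abs_birkhoffAverage_sub_birkhoffAverage_le (f := f) (φ := φ) (ψ := fun _ => 0)
          (le_max_right C 0) (fun x => by simpa using Or.inl (hC' x)) N x
        simpa [birkhoffAverage, birkhoffSum] using this
      · exact ae_restrict_of_ae (h.mono fun x hx => hx φ hφ (HasCompactSupport.of_compactSpace _))
    have hconst : ∀ᶠ N : ℕ in atTop, ∫ x in s, birkhoffAverage ℝ f φ N x ∂μ = ∫ x in s, φ x ∂μ := by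
      filter_upwards [eventually_gt_atTop 0] with N hN
      have hN' : (N : ℝ) ≠ 0 := by positivity
      simp only [birkhoffAverage, birkhoffSum, smul_eq_mul]
      rw [integral_const_mul, integral_finsetSum _ fun i _ => (hci i).integrable_of_compactSpace]
      have : ∀ i : ℕ, ∫ x in s, φ (f^[i] x) ∂μ = ∫ x in s, φ x ∂μ := fun i =>
        measurePreserving_integral_comp (hfs.iterate i) hφ.aestronglyMeasurable
      simp only [this, Finset.sum_const, Finset.card_range, nsmul_eq_mul]
      field_simp
    rw [tendsto_congr' hconst] at hlim
    have := tendsto_nhds_unique tendsto_const_nhds hlim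
    rwa [setIntegral_const, smul_eq_mul] at this
  have hmeas : μ.restrict s = μ s • μ := by
    have : IsFiniteMeasure (μ s • μ) := Measure.smul_finite μ (measure_ne_top μ s)
    refine ext_of_forall_integral_eq_of_IsFiniteMeasure fun φ => ?_
    rw [key φ φ.continuous, integral_smul_measure]
    rfl
  have h0 : μ s * μ sᶜ = 0 := by
    have := congrArg (fun ν : Measure X => ν sᶜ) hmeas
    simpa [Measure.restrict_apply hs.compl] using this.symm
  rw [eventuallyConst_set']
  rcases mul_eq_zero.1 h0 with h0 | h0
  · exact Or.inl (ae_eq_empty.2 h0)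
  · exact Or.inr (ae_eq_univ.2 h0)

lemma TorusDiffeo.measurePreserving_inv (h : TorusDiffeo) :
    MeasurePreserving (h.toPerm⁻¹ : Equiv.Perm Torus) volume volume := by
  let e : Torus ≃ₜ Torus := (continuous_toPerm h).homeoOfEquivCompactToT2
  have := h.measurePreserving
  exact MeasurePreserving.symm e.toMeasurableEquiv this

lemma measurePreserving_circleAction (t : UnitAddCircle) :
    MeasurePreserving (circleAction t) volume volume :=
  measurePreserving_snd_add (c := fun _ => t) measurable_const

lemma measurePreserving_approxMap (n : ℕ) : MeasurePreserving (approxMap n) volume volume :=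
  ((conjState n).H.measurePreserving.comp (measurePreserving_circleAction _)).comp
    (conjState n).H.measurePreserving_inv

lemma measurePreserving_of_tendsto {X : Type*} [PseudoMetricSpace X] [CompactSpace X]
    [MeasurableSpace X] [BorelSpace X] {μ : Measure X} [IsProbabilityMeasure μ] {f : ℕ → X → X}
    {g : X → X} (hf : ∀ n, MeasurePreserving (f n) μ μ) (hg : Continuous g)
    (hlim : ∀ x, Tendsto (fun n => f n x) atTop (𝓝 (g x))) : MeasurePreserving g μ μ := by
  refine ⟨hg.measurable, ?_⟩
  have : IsProbabilityMeasure (μ.map g) := Measure.isProbabilityMeasure_map hg.aemeasurable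
  refine ext_of_forall_integral_eq_of_IsFiniteMeasure fun φ => ?_
  rw [integral_map hg.aemeasurable φ.continuous.aestronglyMeasurable]
  refine tendsto_nhds_unique (f := fun n => ∫ x, φ (f n x) ∂μ) (l := atTop) ?_ ?_
  · refine tendsto_integral_of_dominated_convergence (fun _ => ‖φ‖)
      (fun n => (φ.continuous.measurable.comp (hf n).measurable).aestronglyMeasurable)
      (integrable_const _) (fun n => Eventually.of_forall fun x => φ.norm_coe_le_norm _)
      (Eventually.of_forall fun x => (φ.continuous.tendsto _).comp (hlim x))
  · simp only [measurePreserving_integral_comp (hf _) φ.continuous.aestronglyMeasurable]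
    exact tendsto_const_nhds

/-! ### The invariant circle and the lower bound on the dimension. -/

lemma conjState_H_snd_eq_zero_iff (n : ℕ) (z : Torus) :
    ((conjState n).H.toPerm z).2 = 0 ↔ z.2 = 0 := by
  induction n generalizing z with
  | zero => rfl
  | succ n ih =>
    rw [conjState_succ_H, Equiv.Perm.mul_apply, ih, (conjStepAt n).quasi.snd_eq_zero_iff]

lemma approxMap_snd_eq_zero {z : Torus} (hz : z.2 = 0) (n : ℕ) : (approxMap n z).2 = 0 := by
  rw [approxMap, Equiv.Perm.mul_apply, Equiv.Perm.mul_apply, conjState_H_snd_eq_zero_iff]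
  change ((conjState n).H.toPerm⁻¹ z).2 = 0
  rw [← conjState_H_snd_eq_zero_iff n]
  simpa using hz

instance : (volume : Measure Torus).IsOpenPosMeasure :=
  inferInstanceAs ((volume : Measure UnitAddCircle).prod volume).IsOpenPosMeasure

/-- The distance to the circle is a continuous test function: zero along the orbit, but with
positive integral. -/
lemma not_isBirkhoffGeneric_of_invariant_circle {f : Torus → Torus}
    (hf : ∀ z : Torus, z.2 = 0 → (f z).2 = 0) {z : Torus} (hz : z.2 = 0) :
    ¬ IsBirkhoffGeneric f volume z := by
  intro h
  have hφ : Continuous fun z : Torus => ‖z.2‖ := by fun_prop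
  have h1 := h _ hφ (HasCompactSupport.of_compactSpace _)
  have h2 : ∀ i : ℕ, (f^[i] z).2 = 0 := fun i => by
    induction i with
    | zero => exact hz
    | succ i ih => rw [Function.iterate_succ_apply']; exact hf _ ih
  have h3 : ∀ N : ℕ, birkhoffAverage ℝ f (fun z : Torus => ‖z.2‖) N z = 0 := fun N => by
    simp [birkhoffAverage, birkhoffSum, h2]
  simp only [h3] at h1
  have h4 := tendsto_nhds_unique h1 tendsto_const_nhds
  refine (hφ.integral_pos_of_hasCompactSupport_nonneg_nonzero (μ := volume)
    (HasCompactSupport.of_compactSpace _) (fun _ => norm_nonneg _)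
    (x := ((0 : UnitAddCircle), ((1 / 2 : ℝ) : UnitAddCircle))) ?_).ne' h4
  have : ‖((1 / 2 : ℝ) : UnitAddCircle)‖ = 1 / 2 := by
    rw [unitAddCircle_norm_coe_eq] <;> norm_num [abs_of_pos]
  simp only [this]
  norm_num

/-- Arc length agrees with the Euclidean distance on `[0, 1/2]`, so a half circle is an isometric
copy of an interval. -/
lemma one_le_dimH_circle : 1 ≤ dimH {z : Torus | z.2 = 0} := by
  let g : Set.Icc (0 : ℝ) (1 / 2) → Torus := fun x => ((x : ℝ), 0)
  have hg : Isometry g := by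
    refine Isometry.of_dist_eq fun x y => ?_
    rw [Prod.dist_eq, dist_self, max_eq_left dist_nonneg, dist_eq_norm, ← AddCircle.coe_sub,
      unitAddCircle_norm_coe_eq, Subtype.dist_eq, Real.dist_eq]
    have hx := x.2
    have hy := y.2
    rw [Set.mem_Icc] at hx hy
    rw [abs_le]
    constructor <;> linarith
  have h1 : dimH (Set.univ : Set (Set.Icc (0 : ℝ) (1 / 2))) = 1 := by
    have h2 := (isometry_subtype_coe (s := Set.Icc (0 : ℝ) (1 / 2))).dimH_image Set.univ
    rw [Set.image_univ, Subtype.range_coe] at h2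
    rw [← h2, Real.dimH_of_nonempty_interior] <;> simp
  calc (1 : ENNReal) = dimH (g '' Set.univ) := by rw [hg.dimH_image, h1]
    _ ≤ _ := dimH_mono (by rintro _ ⟨x, -, rfl⟩; rfl)

/-! ### Measure and Hausdorff dimension of the limsup of the bad sets. -/

lemma volume_badSet_le (n : ℕ) : volume (badSet n) ≤ ENNReal.ofReal (4 * (1 / 2 : ℝ) ^ n) := by
  set κ : ℝ := 1 / (conjStepAt n).J with hκ
  set c := ((1 / 2 : ℝ) : UnitAddCircle)
  have hJ : (2 : ℝ) ^ n ≤ (conjStepAt n).J := by exact_mod_cast (conjStepAt n).two_pow_le_J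
  have hκ' : κ ≤ (1 / 2 : ℝ) ^ n := by
    rw [hκ, one_div, one_div, inv_pow]
    gcongr
  have hball : volume (Metric.closedBall (0 : UnitAddCircle) κ) ≤ ENNReal.ofReal (2 * κ) := by
    rw [AddCircle.volume_closedBall]
    exact ENNReal.ofReal_le_ofReal (min_le_right _ _)
  have hbm : NullMeasurableSet (Metric.closedBall (0 : UnitAddCircle) κ) volume :=
    Metric.isClosed_closedBall.nullMeasurableSet
  have h1 : MeasurePreserving (fun w : Torus => -c - (conjState n).q • w.1) volume volume :=
    (measurePreserving_sub_nsmul (conjState n).q_pos (-c)).comp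
      (measurePreserving_fst (μ := (volume : Measure UnitAddCircle))
        (ν := (volume : Measure UnitAddCircle)))
  have h2 : MeasurePreserving (fun w : Torus => w.2) volume volume :=
    measurePreserving_snd (μ := (volume : Measure UnitAddCircle))
      (ν := (volume : Measure UnitAddCircle))
  have himg : badSet n = ((conjState n).H.toPerm⁻¹ : Equiv.Perm Torus) ⁻¹' badStrip n :=
    Equiv.image_eq_preimage_symm _ _
  have hstrip : badStrip n = (fun w : Torus => -c - (conjState n).q • w.1) ⁻¹'
      Metric.closedBall 0 κ ∪ (fun w : Torus => w.2) ⁻¹' Metric.closedBall 0 κ := by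
    ext w
    have hw : -((conjState n).q • w.1) - c = -c - (conjState n).q • w.1 := by abel
    simp only [Set.mem_union, Set.mem_preimage, mem_closedBall_zero_iff]
    rw [← hw]
    exact Iff.rfl
  have hm : MeasurableSet (badStrip n) := by
    rw [hstrip]
    exact (h1.measurable Metric.isClosed_closedBall.measurableSet).union
      (h2.measurable Metric.isClosed_closedBall.measurableSet)
  rw [himg, (conjState n).H.measurePreserving_inv.measure_preimage hm.nullMeasurableSet, hstrip]
  calc _ ≤ _ + _ := measure_union_le _ _
    _ ≤ ENNReal.ofReal (2 * κ) + ENNReal.ofReal (2 * κ) := by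
      rw [h1.measure_preimage hbm, h2.measure_preimage hbm]
      gcongr
    _ = ENNReal.ofReal (4 * κ) := by
      rw [← ENNReal.ofReal_add (by positivity) (by positivity)]
      congr 1
      ring
    _ ≤ _ := ENNReal.ofReal_le_ofReal (by linarith)

lemma volume_frequently_badSet : volume {x | ∃ᶠ n in atTop, x ∈ badSet n} = 0 := by
  refine measure_setOfPred_frequently_eq_zero (ne_top_of_le_ne_top ?_
    (ENNReal.tsum_le_tsum volume_badSet_le))
  rw [← ENNReal.ofReal_tsum_of_nonneg (fun n => by positivity)
    (summable_geometric_two.mul_left 4)]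
  exact ENNReal.ofReal_ne_top

lemma exists_dist_grid_le {J : ℕ} (hJ : 0 < J) (y : UnitAddCircle) :
    ∃ b : Fin J, dist y ((b / J : ℝ) : UnitAddCircle) ≤ 1 / J := by
  have hJ' : (0 : ℝ) < J := by exact_mod_cast hJ
  obtain ⟨r, hr⟩ := QuotientAddGroup.mk_surjective y
  have hy : y = ((Int.fract r : ℝ) : UnitAddCircle) := by
    rw [← hr, ← sub_eq_zero]
    change (r : UnitAddCircle) - _ = 0
    rw [← AddCircle.coe_sub, Int.self_sub_fract]
    exact unitAddCircle_coe_intCast _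
  have h0 : 0 ≤ Int.fract r * J := mul_nonneg (Int.fract_nonneg r) hJ'.le
  have hlt : ⌊Int.fract r * J⌋₊ < J := by
    rw [Nat.floor_lt h0]
    nlinarith [Int.fract_lt_one r]
  refine ⟨⟨_, hlt⟩, ?_⟩
  rw [hy, dist_eq_norm, ← AddCircle.coe_sub]
  refine (unitAddCircle_norm_coe_le _).trans ?_
  have h1 := Nat.floor_le h0
  have h2 := Nat.lt_floor_add_one (Int.fract r * J)
  have h3 : Int.fract r - (⌊Int.fract r * J⌋₊ : ℝ) / J =
      (Int.fract r * J - ⌊Int.fract r * J⌋₊) / J := by field_simp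
  simp only
  rw [h3, abs_div, abs_of_pos hJ']
  gcongr
  rw [abs_le]
  constructor <;> linarith

/-- The centres solve `-Q x = 1/2`. Dividing by `Q` would give `κ / Q`; the weaker `κ` lets vertical
and horizontal strips be covered by balls of the same radius. -/
lemma exists_dist_center_le {Q : ℕ} (hQ : 0 < Q) {κ : ℝ} {x : UnitAddCircle}
    (hx : ‖-(Q • x) - ((1 / 2 : ℝ) : UnitAddCircle)‖ ≤ κ) :
    ∃ a : Fin Q, dist x ((-(a + 1 / 2) / Q : ℝ) : UnitAddCircle) ≤ κ := by
  have hQ' : (0 : ℝ) < Q := by exact_mod_cast hQ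
  have hQ1 : (1 : ℝ) ≤ Q := by exact_mod_cast hQ
  obtain ⟨r, rfl⟩ := QuotientAddGroup.mk_surjective x
  change ‖-(Q • (r : UnitAddCircle)) - _‖ ≤ κ at hx
  rw [← AddCircle.coe_nsmul, ← AddCircle.coe_neg, ← AddCircle.coe_sub, UnitAddCircle.norm_eq,
    nsmul_eq_mul] at hx
  set m := round (-(Q * r) - 1 / 2) with hm
  have hmod0 : 0 ≤ m % Q := Int.emod_nonneg _ (by omega)
  have hmodlt : m % Q < Q := Int.emod_lt_of_pos _ (by omega)
  refine ⟨⟨(m % Q).toNat, by omega⟩, ?_⟩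
  have hcast : (((m % Q).toNat : ℕ) : ℝ) = ((m % Q : ℤ) : ℝ) := by
    exact_mod_cast congrArg (Int.cast : ℤ → ℝ) (Int.toNat_of_nonneg hmod0)
  have hdecomp : (m : ℝ) = Q * ((m / Q : ℤ) : ℝ) + ((m % Q : ℤ) : ℝ) := by
    exact_mod_cast (Int.mul_ediv_add_emod m Q).symm
  simp only [hcast]
  have hcenter : ((-(((m % Q : ℤ) : ℝ) + 1 / 2) / Q : ℝ) : UnitAddCircle) =
      ((-((m : ℝ) + 1 / 2) / Q : ℝ) : UnitAddCircle) := by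
    rw [← sub_eq_zero, ← AddCircle.coe_sub]
    have : -(((m % Q : ℤ) : ℝ) + 1 / 2) / Q - -((m : ℝ) + 1 / 2) / Q = ((m / Q : ℤ) : ℝ) := by
      rw [hdecomp]
      field_simp
      ring
    rw [this]
    exact unitAddCircle_coe_intCast _
  rw [hcenter]
  change dist (r : UnitAddCircle) _ ≤ κ
  rw [dist_eq_norm, ← AddCircle.coe_sub]
  refine (unitAddCircle_norm_coe_le _).trans ?_
  have h1 : r - -((m : ℝ) + 1 / 2) / Q = -(-(Q * r) - 1 / 2 - m) / Q := by field_simp; ring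
  rw [h1, abs_div, abs_neg, abs_of_pos hQ', div_le_iff₀ hQ']
  exact hx.trans (le_mul_of_one_le_right ((abs_nonneg _).trans hx) hQ1)

/-- The centers of the balls covering the exceptional strips. -/
noncomputable def stripCenter (Q J : ℕ) (i : Option (Fin Q) × Fin J) : Torus :=
  match i.1 with
  | some a => (((-(a + 1 / 2) / Q : ℝ) : UnitAddCircle), ((i.2 / J : ℝ) : UnitAddCircle))
  | none => (((i.2 / J : ℝ) : UnitAddCircle), 0)

/-- The index type of the covering of the exceptional set. -/
abbrev CoverIndex (n : ℕ) : Type := Option (Fin (conjState n).q) × Fin (conjStepAt n).J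

/-- The sets covering the exceptional set. -/
noncomputable def coverSet (n : ℕ) (i : CoverIndex n) : Set Torus :=
  (conjState n).H.toPerm '' Metric.closedBall (stripCenter _ _ i) (1 / (conjStepAt n).J)

lemma badSet_subset (n : ℕ) : badSet n ⊆ ⋃ i, coverSet n i := by
  rintro _ ⟨w, hw, rfl⟩
  have hJ := (conjStepAt n).J_pos
  rcases hw with hw | hw
  · obtain ⟨a, ha⟩ := exists_dist_center_le (conjState n).q_pos hw
    obtain ⟨b, hb⟩ := exists_dist_grid_le hJ w.2
    exact Set.mem_iUnion.2 ⟨(some a, b), w, max_le ha hb, rfl⟩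
  · obtain ⟨b, hb⟩ := exists_dist_grid_le hJ w.1
    refine Set.mem_iUnion.2 ⟨(none, b), w, max_le hb ?_, rfl⟩
    simpa [stripCenter, dist_eq_norm] using hw

lemma ediam_coverSet_le (n : ℕ) (i : CoverIndex n) :
    Metric.ediam (coverSet n i) ≤ ENNReal.ofReal (2 * (conjState n).L / (conjStepAt n).J) := by
  refine Metric.ediam_le ?_
  rintro _ ⟨u, hu, rfl⟩ _ ⟨v, hv, rfl⟩
  rw [edist_dist]
  refine ENNReal.ofReal_le_ofReal (((conjState n).lipschitz.dist_le_mul u v).trans ?_)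
  rw [Metric.mem_closedBall] at hu hv
  have := dist_triangle_right u v (stripCenter _ _ i)
  rw [NNReal.coe_natCast]
  calc ((conjState n).L : ℝ) * dist u v ≤ (conjState n).L * (2 * (1 / (conjStepAt n).J)) := by
        gcongr
        linarith
    _ = _ := by ring

/-- Numerical core of the covering estimate. -/
lemma card_mul_rpow_le {Q L J : ℕ} (hL : 0 < L) (hJ : 0 < J) {n : ℕ}
    (h : (2 ^ n * (Q + 1) * (2 * L) ^ 2) ^ n ≤ J) {e : ℝ} (he : e ≤ 1) (hn : 1 ≤ n * e) :
    ((Q + 1) * J : ℝ) * (2 * L / J : ℝ) ^ (1 + e) ≤ (1 / 2 : ℝ) ^ n := by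
  have hJ' : (0 : ℝ) < J := by exact_mod_cast hJ
  have hL' : (1 : ℝ) ≤ 2 * L := by
    have : (1 : ℝ) ≤ L := by exact_mod_cast hL
    linarith
  have he0 : 0 ≤ e := by
    by_contra! hneg
    have : (n : ℝ) * e ≤ 0 := mul_nonpos_of_nonneg_of_nonpos (by positivity) hneg.le
    linarith
  set X : ℝ := 2 ^ n * (Q + 1) * (2 * L) ^ 2 with hX
  have hX1 : 1 ≤ X := by
    have h1 : (1 : ℝ) ≤ 2 ^ n := one_le_pow₀ (by norm_num)
    have h2 : (1 : ℝ) ≤ Q + 1 := by linarith [(Nat.cast_nonneg Q : (0 : ℝ) ≤ Q)]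
    have h3 : (1 : ℝ) ≤ (2 * L) ^ 2 := one_le_pow₀ hL'
    exact one_le_mul_of_one_le_of_one_le (one_le_mul_of_one_le_of_one_le h1 h2) h3
  -- Since `X ≥ 1` and `n e ≥ 1`, `X ≤ (X ^ n) ^ e ≤ J ^ e`. Of the factor `J ^ (1 + e)` in the
  -- denominator, `J` cancels the number of balls along a strip and `J ^ e` absorbs everything else.
  have hXJ : X ≤ (J : ℝ) ^ e := by
    have h1 : X ^ n ≤ (J : ℝ) := by rw [hX]; exact_mod_cast h
    calc X = X ^ (1 : ℝ) := (Real.rpow_one X).symm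
      _ ≤ X ^ (n * e) := Real.rpow_le_rpow_of_exponent_le hX1 hn
      _ = (X ^ n) ^ e := by rw [Real.rpow_mul (by positivity), Real.rpow_natCast]
      _ ≤ _ := Real.rpow_le_rpow (by positivity) h1 he0
  have hLe : (2 * L : ℝ) ^ (1 + e) ≤ (2 * L) ^ 2 := by
    rw [← Real.rpow_natCast]
    exact Real.rpow_le_rpow_of_exponent_le hL' (by push_cast; linarith)
  rw [Real.div_rpow (by positivity) hJ'.le, Real.rpow_add hJ', Real.rpow_one]
  have hJe : 0 < (J : ℝ) ^ e := Real.rpow_pos_of_pos hJ' e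
  calc ((Q + 1) * J : ℝ) * ((2 * L : ℝ) ^ (1 + e) / (J * (J : ℝ) ^ e)) =
      (Q + 1) * (2 * L : ℝ) ^ (1 + e) / (J : ℝ) ^ e := by field_simp
    _ ≤ (Q + 1) * (2 * L : ℝ) ^ 2 / X := by gcongr
    _ = (1 / 2 : ℝ) ^ n := by
      rw [hX, one_div, inv_pow]
      field_simp

lemma sum_ediam_coverSet_le {n : ℕ} {e : ℝ} (he : e ≤ 1) (hn : 1 ≤ n * e) (he0 : 0 ≤ 1 + e) :
    ∑' i, Metric.ediam (coverSet n i) ^ (1 + e) ≤ ENNReal.ofReal ((1 / 2 : ℝ) ^ n) := by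
  have h1 := card_mul_rpow_le (conjState n).L_pos (conjStepAt n).J_pos (conjStepAt n).pow_le_J he hn
  refine le_trans ?_ (ENNReal.ofReal_le_ofReal h1)
  rw [tsum_fintype]
  refine (Finset.sum_le_card_nsmul _ _ _ fun i _ =>
    ENNReal.rpow_le_rpow (ediam_coverSet_le n i) he0).trans (le_of_eq ?_)
  rw [ENNReal.ofReal_rpow_of_nonneg (by positivity) he0, nsmul_eq_mul,
    ENNReal.ofReal_mul (by positivity)]
  congr 1
  simp only [Finset.card_univ, Fintype.card_prod, Fintype.card_option, Fintype.card_fin]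
  rw [← ENNReal.ofReal_natCast]
  congr 1
  push_cast
  ring

lemma L_div_J_le {n : ℕ} (hn : 1 ≤ n) :
    2 * ((conjState n).L : ℝ) / (conjStepAt n).J ≤ (1 / 2 : ℝ) ^ n := by
  have hJ : (0 : ℝ) < (conjStepAt n).J := by exact_mod_cast (conjStepAt n).J_pos
  have hL : (1 : ℝ) ≤ (conjState n).L := by exact_mod_cast (conjState n).L_pos
  have h1 : ((2 : ℝ) ^ n * ((conjState n).q + 1) * (2 * (conjState n).L) ^ 2) ^ n ≤
      (conjStepAt n).J := by exact_mod_cast (conjStepAt n).pow_le_J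
  have hq := conjState_q_pos n
  have h2 : (1 : ℝ) ≤ 2 ^ n := one_le_pow₀ (by norm_num)
  have h3 : (2 : ℝ) ^ n * (2 * (conjState n).L) ≤
      (2 : ℝ) ^ n * ((conjState n).q + 1) * (2 * (conjState n).L) ^ 2 := by
    rw [mul_assoc ((2 : ℝ) ^ n)]
    refine mul_le_mul_of_nonneg_left ?_ (by positivity)
    calc (2 * (conjState n).L : ℝ) ≤ (2 * (conjState n).L) ^ 2 :=
          le_self_pow₀ (by linarith) two_ne_zero
      _ ≤ _ := le_mul_of_one_le_left (by positivity)
        (le_add_of_nonneg_left (Nat.cast_nonneg _))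
  have h4 : (1 : ℝ) ≤ (2 : ℝ) ^ n * ((conjState n).q + 1) * (2 * (conjState n).L) ^ 2 := by
    refine le_trans ?_ h3
    nlinarith
  have h5 := le_self_pow₀ h4 (n := n) (by omega)
  rw [div_le_iff₀ hJ, one_div, inv_pow, inv_mul_eq_div, le_div_iff₀ (by positivity)]
  linarith

/-- Borel–Cantelli for Hausdorff measure: the covers of all stages from `N` on cover the limsup set,
and their `(1 + e)`-sums are bounded by a geometric tail once `N e ≥ 1`. -/
lemma hausdorffMeasure_frequently_badSet {e : ℝ} (he0 : 0 < e) (he : e ≤ 1) :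
    μH[1 + e] {x | ∃ᶠ n in atTop, x ∈ badSet n} = 0 := by
  have hgeo : Tendsto (fun N : ℕ => ENNReal.ofReal ((1 / 2 : ℝ) ^ N)) atTop (𝓝 0) := by
    rw [← ENNReal.ofReal_zero]
    exact ENNReal.tendsto_ofReal
      (tendsto_pow_atTop_nhds_zero_of_lt_one (by norm_num) (by norm_num))
  have h := Measure.hausdorffMeasure_le_liminf_tsum (1 + e) {x | ∃ᶠ n in atTop, x ∈ badSet n}
    (l := atTop) (ι := fun N : ℕ => Σ k : ℕ, CoverIndex (N + k))
    (fun N => ENNReal.ofReal ((1 / 2 : ℝ) ^ N)) hgeo (fun N i => coverSet (N + i.1) i.2) ?_ ?_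
  · refine le_antisymm (h.trans ?_) zero_le
    have hbound : ∀ᶠ N : ℕ in atTop,
        ∑' i : Σ k : ℕ, CoverIndex (N + k), Metric.ediam (coverSet (N + i.1) i.2) ^ (1 + e) ≤
        ENNReal.ofReal (2 * (1 / 2 : ℝ) ^ N) := by
      obtain ⟨N₀, hN₀⟩ := exists_nat_ge (1 / e)
      filter_upwards [eventually_ge_atTop N₀] with N hN
      rw [ENNReal.tsum_sigma']
      have hk : ∀ k : ℕ, ∑' i : CoverIndex (N + k), Metric.ediam (coverSet (N + k) i) ^ (1 + e) ≤
          ENNReal.ofReal ((1 / 2 : ℝ) ^ N * (1 / 2 : ℝ) ^ k) := fun k => by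
        rw [← pow_add]
        refine sum_ediam_coverSet_le he ?_ (by linarith)
        rw [← div_le_iff₀ he0]
        refine hN₀.trans ?_
        exact_mod_cast hN.trans (Nat.le_add_right _ _)
      refine (ENNReal.tsum_le_tsum hk).trans (le_of_eq ?_)
      rw [← ENNReal.ofReal_tsum_of_nonneg (fun k => by positivity)
        (summable_geometric_two.mul_left _), tsum_mul_left, tsum_geometric_two, mul_comm]
    have hlim : Tendsto (fun N : ℕ => ENNReal.ofReal (2 * (1 / 2 : ℝ) ^ N)) atTop (𝓝 0) := by
      have h0 := (tendsto_pow_atTop_nhds_zero_of_lt_one (r := (1 / 2 : ℝ)) (by norm_num)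
        (by norm_num)).const_mul 2
      rw [mul_zero] at h0
      rw [← ENNReal.ofReal_zero]
      exact ENNReal.tendsto_ofReal h0
    exact (liminf_le_liminf hbound).trans hlim.liminf_eq.le
  · filter_upwards [eventually_ge_atTop 1] with N hN i
    refine (ediam_coverSet_le _ _).trans (ENNReal.ofReal_le_ofReal
      ((L_div_J_le (by omega)).trans ?_))
    exact pow_le_pow_of_le_one (by norm_num) (by norm_num) (Nat.le_add_right _ _)
  · refine Eventually.of_forall fun N x hx => ?_
    obtain ⟨m, hm, hxm⟩ := (frequently_atTop.1 hx) N
    obtain ⟨k, rfl⟩ := Nat.exists_eq_add_of_le hm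
    obtain ⟨i, hi⟩ := Set.mem_iUnion.1 (badSet_subset _ hxm)
    exact Set.mem_iUnion.2 ⟨⟨k, i⟩, hi⟩

lemma dimH_frequently_badSet_le : dimH {x | ∃ᶠ n in atTop, x ∈ badSet n} ≤ 1 := by
  refine dimH_le fun d hd => ?_
  by_contra! hlt
  have hd1 : (1 : ℝ) < d := by exact_mod_cast hlt
  -- The excess over dimension `1` is truncated at `1` because the covering estimate bounds `(2 L) ^
  -- (1 + e)` by `(2 L) ^ 2`; monotonicity in the dimension returns to `d`.
  have h1 := hausdorffMeasure_frequently_badSet (e := min (d - 1) 1) (lt_min (by linarith) one_pos)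
    (min_le_right _ _)
  have h2 := Measure.hausdorffMeasure_mono (X := Torus) (d₁ := 1 + min ((d : ℝ) - 1) 1) (d₂ := d)
    (by linarith [min_le_left ((d : ℝ) - 1) 1]) {x | ∃ᶠ n in atTop, x ∈ badSet n}
  rw [h1, hd] at h2
  simp at h2

/-! ### Conclusion. -/

/-- An ergodic diffeomorphism constructed by approximation by conjugation whose nongeneric points
form a null set of Hausdorff dimension one. -/
theorem exists_isAbC_dimH_nonGenericSet_eq_one : ∃ T : Equiv.Perm Torus,
    IsSmoothDiffeo T ∧ IsAbC T ∧ Ergodic T (volume : Measure Torus) ∧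
      (volume : Measure Torus) (nonGenericSet T volume) = 0 ∧
      dimH (nonGenericSet T (volume : Measure Torus)) = 1 := by
  obtain ⟨T, hT, hTs, hTs', hTu⟩ := exists_conjLimit
  have hc : Continuous T := hT.continuous
  have hsub : nonGenericSet T volume ⊆ {x | ∃ᶠ n in atTop, x ∈ badSet n} := by
    intro x hx
    by_contra hbad
    exact hx (isBirkhoffGeneric_of_lipschitz fun ψ Λ hψ =>
      tendsto_birkhoffAverage_of_lipschitz hTu hc hψ (not_frequently.1 hbad))
  have hnull : volume (nonGenericSet T (volume : Measure Torus)) = 0 :=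
    measure_mono_null hsub volume_frequently_badSet
  have hmp : MeasurePreserving T volume volume :=
    measurePreserving_of_tendsto
      (fun n => by rw [conjScheme_T_eq]; exact measurePreserving_approxMap (n + 1)) hc
      (fun x => hTu.tendsto_at x)
  have hcircle : ∀ z : Torus, z.2 = 0 → (T z).2 = 0 := fun z hz => by
    refine tendsto_nhds_unique ((continuous_snd.tendsto _).comp (hTu.tendsto_at z)) ?_
    refine tendsto_const_nhds.congr fun n => ?_
    simp only [Function.comp, conjScheme_T_eq, approxMap_snd_eq_zero hz]
  have hsup : {z : Torus | z.2 = 0} ⊆ nonGenericSet T volume := fun z hz =>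
    not_isBirkhoffGeneric_of_invariant_circle hcircle hz
  have hae : ∀ᵐ x, IsBirkhoffGeneric T (volume : Measure Torus) x := by
    rw [ae_iff]
    exact hnull
  exact ⟨T, hT, ⟨conjScheme, hTs, hTs'⟩, ergodic_of_ae_isBirkhoffGeneric hmp hc hae, hnull,
    le_antisymm ((dimH_mono hsub).trans dimH_frequently_badSet_le)
      (one_le_dimH_circle.trans (dimH_mono hsup))⟩

/-- The same `T` works for all `α`, because its non-generic set has dimension `1` and `α - 1 ≤ 1 ≤
α`. -/
theorem theoremE (α : ℝ) (hα₁ : 1 < α) (hα₂ : α < 2) :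
    ∃ T : Equiv.Perm Torus,
      IsSmoothDiffeo T ∧ IsAbC T ∧ Ergodic T (volume : Measure Torus) ∧
      (volume : Measure Torus) (nonGenericSet T volume) = 0 ∧
      ENNReal.ofReal (α - 1) ≤ dimH (nonGenericSet T (volume : Measure Torus)) ∧
      dimH (nonGenericSet T (volume : Measure Torus)) ≤ ENNReal.ofReal α := by
  obtain ⟨T, h1, h2, h3, h4, h5⟩ := exists_isAbC_dimH_nonGenericSet_eq_one
  refine ⟨T, h1, h2, h3, h4, ?_, ?_⟩
  · rw [h5, ENNReal.ofReal_le_one]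
    linarith
  · rw [h5, ENNReal.one_le_ofReal]
    exact hα₁.le
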